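/- A locale $X$ is identified with its frame; a map of locales $f:X\to Y$ has inverse image $f^*:Y\to X$, a frame homomorphism. $f$ is a surjection if $f^*$ is injective, and open if $f^*$ has a left adjoint $f_!$ with $f_!(x\wedge f^*(y))=f_!(x)\wedge y$. A localic groupoid $G$ (an internal groupoid in locales, with domain $d$, range $r$, units $u$, inversion $i$ and multiplication $m$, where $gh$ is defined when $r(g)=d(h)$) is open if $d$ is open. Let $G$ be an open localic groupoid and put $A=G_0$. The quantale $Q=\mathcal O(G)$ is the frame $G_1$ with $qq'=m_!(q\otimes q')$, $q^*=i_!(q)$, ${}^{a}q=d^*(a)\wedge q$, $q^{a}=q\wedge r^*(a)$, $\varsigma_Q=d_!$ and $\upsilon=u^*:Q\to A$. **Bundles.** A $G$-locale is a locale $X$ with maps $p:X\to G_0$ and $\mathsf a:G_1\times_{G_0}X\to X$ (the pullback of $r$ and $p$), $(g,x)\mapsto gx$, such that $p(gx)=d(g)$, $(gh)x=g(hx)$ and $u(p(x))x=x$ (as identities between maps of locales). A fully open principal $G$-bundle over a locale $M$ is a $G$-locale $X$ whose anchor map $p$ is an open surjection, with an open surjection $\pi:X\to M$ such that $\pi(gx)=\pi(x)$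 and such that $\langle \mathsf a,\pi_2\rangle:G_1\times_{G_0}X\to X\times_M X$ is an isomorphism. Its inverse has the form $\langle\theta,\pi_2\rangle$ with $\theta:X\times_M X\to G_1$. **Principal $Q$-locales.** A principal $Q$-locale over $M$ is a locale $X$ with an action $(q,x)\mapsto q\cdot x$ of $Q$ (associative, join-preserving in each variable) and a unital $A$-module structure $(a,x)\mapsto {}^{a}x$ (also join-preserving in each variable) such that $$({}^{a}q)\cdot x={}^{a}(q\cdot x),\qquad (q^{a})\cdot x=q\cdot({}^{a}x),\qquad {}^{a}(x\wedge y)={}^{a}x\wedge y;$$ with an inner product $\langle-,-\rangle:X\times X\to Q$ such that $$\langle q\cdot x,y\rangle=q\langle x,y\rangle,\quad {}^{a}\langle x,1_X\rangle=\langle {}^{a}x,1_X\rangle,\quad \Big\langle \bigvee_j x_j,y\Big\rangle=\bigvee_j\langle x_j,y\rangle,\quad \langle x,y\rangle=\langle y,x\rangle^*;$$ with a monotone map $\varsigma_X:X\to A$ (the support) such that $$\varsigma_X(1_X)=1_A,\quad {}^{\varsigma_X(x)}1_X\le\langle x,x\rangle\cdot 1_X,\quad {}^{\varsigma_X(x)}x=x,\quad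 \varsigma_X(q\cdot x)\le\varsigma_Q(q);$$ and with a map of locales $\pi:X\to M$, such that the following hold for all $q\in Q$, $x,y\in X$: - Q1: the map $\alpha_*:X\to Q\otimes_A X$, $\alpha_*(x)=\bigvee_{q\cdot y\le x}q\otimes y$, preserves arbitrary joins; - Q2: $\bigvee_{q\cdot y\le x}{}^{\upsilon(q)}y=x$; - P1: $\pi$ is open and $\pi_!(1_X)=1_M$; - P2: $\pi_!(q\cdot x)=\pi_!({}^{\varsigma_Q(q^*)}x)$; - P3: $x\otimes y\mapsto\bigvee_{q\cdot z\le x}q\otimes(z\wedge y)$ defines a frame isomorphism $X\otimes_M X\to Q\otimes_A X$. Two principal $Q$-locales over $M$ on the same locale $X$ are identified if they have the same $Q$-action, $A$-action, support and map $\pi$, that is, if they differ at most in the choice of the inner product. **Corollary.** Let $G$ be an open localic groupoid and $M$ a locale. For every fully open principal $G$-bundle $X$ over $M$, the frame $\mathcal O(X)=X$ with $$q\cdot x=\mathsf a_!(q\otimes x),\quad {}^{a}x=p^*(a)\wedge x,\quad \langle x,y\rangle=\theta_!(x\otimes y),\quad \varsigma_X=p_!,$$ and with the same map $\pi$, is a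 principal $\mathcal O(G)$-locale over $M$; and the assignment $X\mapsto\mathcal O(X)$ is a bijection from the fully open principal $G$-bundles over $M$ to the principal $\mathcal O(G)$-locales over $M$, identified as above. -/

import Mathlib

universe u

/-! ## Maps of locales

A locale is given by its frame, and a map of locales `X → Y` by its inverse image homomorphism,
that is, by a frame homomorphism `FrameHom Y X`. -/

section Locales

variable {L M : Type u} [Order.Frame L] [Order.Frame M]

/-- The direct image `f_! : L → M` of the map of locales `L → M` with inverse image `f : M → L`.
It is the left adjoint of `f` whenever `f` has one (see `IsOpenLocaleMap`). -/
def directImage (f : FrameHom M L) (a : L) : M := sInf {b | a ≤ f b}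

/-- A map of locales, given by its inverse image `f`, is open: `f` has a left adjoint `f_!`
satisfying the Frobenius condition `f_! (a ∧ f b) = f_! a ∧ b`. -/
def IsOpenLocaleMap (f : FrameHom M L) : Prop :=
  GaloisConnection (directImage f) f ∧
    ∀ (a : L) (b : M), directImage f (a ⊓ f b) = directImage f a ⊓ b

/-- A map of locales, given by its inverse image `f`, is a surjection
(an epimorphism of locales): `f` is injective. -/
def IsLocaleSurjection (f : FrameHom M L) : Prop := Function.Injective f

/-- A bijective frame homomorphism (the inverse image of an isomorphism of locales),
as an order isomorphism. -/
noncomputable def FrameHom.orderIsoOfBijective (f : FrameHom M L) (hf : Function.Bijective f) :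
    M ≃o L where
  toEquiv := Equiv.ofBijective f hf
  map_rel_iff' := by
    intro a b
    change f a ≤ f b ↔ a ≤ b
    rw [← inf_eq_left, ← map_inf, hf.1.eq_iff, inf_eq_left]

/-- The inverse of a bijective frame homomorphism. -/
noncomputable def FrameHom.inverse (f : FrameHom M L) (hf : Function.Bijective f) :
    FrameHom L M :=
  ((f.orderIsoOfBijective hf).symm : FrameHom L M)

end Locales

/-! ## Tensor products of sup-lattices over an acting locale -/

section Tensor

variable {L M A : Type u} [CompleteLattice L] [CompleteLattice M]

/-- The tensor product `L ⊗_A M` of sup-lattices, where `ρ` is a right action of `A` on `L` and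
`σ` a left action of `A` on `M`. It is the sup-lattice quotient of `L ⊗ M` by the relations
`ρ x a ⊗ y = x ⊗ σ a y`. An element `D` is represented by the set of the pairs `(x, y)` with
`x ⊗ y ≤ D`. -/
@[ext]
structure SupTensor (ρ : L → A → L) (σ : A → M → M) where
  carrier : Set (L × M)
  lower' : ∀ {x x' : L} {y y' : M}, x' ≤ x → y' ≤ y → (x, y) ∈ carrier → (x', y') ∈ carrier
  sSup_left' : ∀ (s : Set L) (y : M), (∀ x ∈ s, (x, y) ∈ carrier) → (sSup s, y) ∈ carrier
  sSup_right' : ∀ (x : L) (s : Set M), (∀ y ∈ s, (x, y) ∈ carrier) → (x, sSup s) ∈ carrier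
  balanced' : ∀ (x : L) (a : A) (y : M), (ρ x a, y) ∈ carrier ↔ (x, σ a y) ∈ carrier

namespace SupTensor

variable {ρ : L → A → L} {σ : A → M → M}

instance : Membership (L × M) (SupTensor ρ σ) where
  mem D z := z ∈ D.carrier

theorem lower (D : SupTensor ρ σ) {x x' : L} {y y' : M} (hx : x' ≤ x) (hy : y' ≤ y)
    (h : (x, y) ∈ D) : (x', y') ∈ D := D.lower' hx hy h

theorem sSup_left (D : SupTensor ρ σ) (s : Set L) (y : M) (h : ∀ x ∈ s, (x, y) ∈ D) :
    (sSup s, y) ∈ D := D.sSup_left' s y h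

theorem sSup_right (D : SupTensor ρ σ) (x : L) (s : Set M) (h : ∀ y ∈ s, (x, y) ∈ D) :
    (x, sSup s) ∈ D := D.sSup_right' x s h

theorem balanced (D : SupTensor ρ σ) (x : L) (a : A) (y : M) :
    (ρ x a, y) ∈ D ↔ (x, σ a y) ∈ D := D.balanced' x a y

/-- Elements of the tensor product are ordered by inclusion. -/
instance : PartialOrder (SupTensor ρ σ) where
  le D E := ∀ z, z ∈ D → z ∈ E
  le_refl _ _ h := h
  le_trans _ _ _ h₁ h₂ z hz := h₂ z (h₁ z hz)
  le_antisymm _ _ h₁ h₂ := SupTensor.ext (Set.ext fun z => ⟨h₁ z, h₂ z⟩)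

theorem le_def {D E : SupTensor ρ σ} : D ≤ E ↔ ∀ z, z ∈ D → z ∈ E := Iff.rfl

instance : InfSet (SupTensor ρ σ) where
  sInf S :=
    { carrier := {z | ∀ D ∈ S, z ∈ D}
      lower' := fun hx hy h D hD => D.lower hx hy (h D hD)
      sSup_left' := fun s y h D hD => D.sSup_left s y fun x hx => h x hx D hD
      sSup_right' := fun x s h D hD => D.sSup_right x s fun y hy => h y hy D hD
      balanced' := fun x a y => forall₂_congr fun D _ => D.balanced x a y }

theorem mem_sInf {S : Set (SupTensor ρ σ)} {z : L × M} : z ∈ sInf S ↔ ∀ D ∈ S, z ∈ D := Iff.rfl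

instance : CompleteLattice (SupTensor ρ σ) :=
  completeLatticeOfInf _ fun _ => ⟨fun D hD _ hz => hz D hD, fun _ hE z hz _ hD => hE hD z hz⟩

theorem mem_inf {D E : SupTensor ρ σ} {z : L × M} : z ∈ D ⊓ E ↔ z ∈ D ∧ z ∈ E := by
  constructor
  · exact fun h => ⟨(inf_le_left : D ⊓ E ≤ D) z h, (inf_le_right : D ⊓ E ≤ E) z h⟩
  · rintro ⟨hD, hE⟩
    change z ∈ sInf {D, E}
    rw [mem_sInf]
    rintro F (rfl | rfl)
    · exact hD
    · exact hE

theorem mem_top (z : L × M) : z ∈ (⊤ : SupTensor ρ σ) := by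
  exact fun D hD => absurd hD (Set.notMem_empty D)

/-- The pure tensor `x ⊗ y`: the least element containing the pair `(x, y)`. -/
def tmul (x : L) (y : M) : SupTensor ρ σ := sInf {D | (x, y) ∈ D}

theorem mem_tmul (x : L) (y : M) : (x, y) ∈ (tmul x y : SupTensor ρ σ) := fun _ hD => hD

theorem tmul_le {x : L} {y : M} {D : SupTensor ρ σ} : tmul x y ≤ D ↔ (x, y) ∈ D :=
  ⟨fun h => h _ (mem_tmul x y), fun h _ hz => hz D h⟩

end SupTensor

end Tensor

/-! ## Pullbacks of locales -/

section Pullback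

variable {B L M : Type u} [Order.Frame B] [Order.Frame L] [Order.Frame M]

/-- The pullback `L ×_B M` of maps of locales `L → B` and `M → B` with inverse images `f` and `g`:
its frame is the tensor product `L ⊗_B M`, where `B` acts on `L` and `M` through `f` and `g`. -/
abbrev LocalePullback (f : FrameHom B L) (g : FrameHom B M) : Type u :=
  SupTensor (fun (x : L) (b : B) => x ⊓ f b) (fun (b : B) (y : M) => g b ⊓ y)

namespace LocalePullback

open SupTensor

variable {f : FrameHom B L} {g : FrameHom B M}

/-- The Heyting implication of `L ⊗_B M`. -/
def imp (D E : LocalePullback f g) : LocalePullback f g where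
  carrier := {z | ∀ x y, x ≤ z.1 → y ≤ z.2 → (x, y) ∈ D → (x, y) ∈ E}
  lower' := fun hx hy h x y hx' hy' => h x y (hx'.trans hx) (hy'.trans hy)
  sSup_left' := by
    intro s y h x' y' hx' hy' hD
    have : x' = sSup ((fun x => x' ⊓ x) '' s) := by
      rw [sSup_image, ← inf_sSup_eq, inf_eq_left.2 hx']
    rw [this]
    refine E.sSup_left _ _ ?_
    rintro _ ⟨x, hx, rfl⟩
    exact h x hx _ _ inf_le_right hy' (D.lower inf_le_left le_rfl hD)
  sSup_right' := by
    intro x s h x' y' hx' hy' hD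
    have : y' = sSup ((fun y => y' ⊓ y) '' s) := by
      rw [sSup_image, ← inf_sSup_eq, inf_eq_left.2 hy']
    rw [this]
    refine E.sSup_right _ _ ?_
    rintro _ ⟨y, hy, rfl⟩
    exact h y hy _ _ hx' inf_le_right (D.lower le_rfl inf_le_left hD)
  balanced' := by
    intro x b y
    constructor
    · intro h x' y' hx' hy' hD
      have hy : g b ⊓ y' = y' := inf_eq_right.2 (hy'.trans inf_le_left)
      have h' := h (x' ⊓ f b) y' (inf_le_inf_right _ hx') (hy'.trans inf_le_right)
        (D.lower inf_le_left le_rfl hD)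
      have h'' := (E.balanced x' b y').1 h'
      rwa [hy] at h''
    · intro h x' y' hx' hy' hD
      have hx : x' ⊓ f b = x' := inf_eq_left.2 (hx'.trans inf_le_right)
      have h' := h x' (g b ⊓ y') (hx'.trans inf_le_left) (inf_le_inf_left _ hy')
        (D.lower le_rfl inf_le_right hD)
      have h'' := (E.balanced x' b y').2 h'
      rwa [hx] at h''

theorem le_imp_iff {C D E : LocalePullback f g} : C ≤ imp D E ↔ C ⊓ D ≤ E := by
  constructor
  · intro h z hz
    rw [mem_inf] at hz
    exact h z hz.1 z.1 z.2 le_rfl le_rfl hz.2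
  · intro h z hz x y hx hy hD
    exact h (x, y) (mem_inf.2 ⟨C.lower hx hy hz, hD⟩)

instance : Order.Frame (LocalePullback f g) :=
  Order.Frame.ofMinimalAxioms
    { inf_sSup_le_iSup_inf := fun D S => by
        rw [inf_comm, ← le_imp_iff]
        refine sSup_le fun C hC => ?_
        rw [le_imp_iff, inf_comm]
        exact le_iSup₂ (f := fun C (_ : C ∈ S) => D ⊓ C) C hC }

theorem tmul_inf_tmul (x x' : L) (y y' : M) :
    (tmul x y ⊓ tmul x' y' : LocalePullback f g) = tmul (x ⊓ x') (y ⊓ y') := by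
  apply le_antisymm
  · rw [← le_imp_iff, tmul_le]
    intro s t hs ht hst
    let E : LocalePullback f g :=
      { carrier := {z | (z.1 ⊓ x, z.2 ⊓ y) ∈ (tmul (x ⊓ x') (y ⊓ y') : LocalePullback f g)}
        lower' := by
          intro v v' w w' hv hw h
          exact SupTensor.lower (tmul (x ⊓ x') (y ⊓ y') : LocalePullback f g)
            (inf_le_inf_right x hv) (inf_le_inf_right y hw) h
        sSup_left' := by
          intro s v h
          change (sSup s ⊓ x, v ⊓ y) ∈ (tmul (x ⊓ x') (y ⊓ y') : LocalePullback f g)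
          rw [sSup_inf_eq, ← sSup_image]
          refine SupTensor.sSup_left _ _ _ ?_
          rintro _ ⟨w, hw, rfl⟩
          exact h w hw
        sSup_right' := by
          intro v s h
          change (v ⊓ x, sSup s ⊓ y) ∈ (tmul (x ⊓ x') (y ⊓ y') : LocalePullback f g)
          rw [sSup_inf_eq, ← sSup_image]
          refine SupTensor.sSup_right _ _ _ ?_
          rintro _ ⟨w, hw, rfl⟩
          exact h w hw
        balanced' := by
          intro v b w
          change (v ⊓ f b ⊓ x, w ⊓ y) ∈ (tmul (x ⊓ x') (y ⊓ y') : LocalePullback f g) ↔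
            (v ⊓ x, g b ⊓ w ⊓ y) ∈ (tmul (x ⊓ x') (y ⊓ y') : LocalePullback f g)
          rw [inf_right_comm, inf_assoc (g b)]
          exact SupTensor.balanced _ (v ⊓ x) b (w ⊓ y) }
    have hE : (tmul x' y' : LocalePullback f g) ≤ E := by
      rw [tmul_le]
      change (x' ⊓ x, y' ⊓ y) ∈ (tmul (x ⊓ x') (y ⊓ y') : LocalePullback f g)
      rw [inf_comm x', inf_comm y']
      exact mem_tmul _ _
    have h : (s ⊓ x, t ⊓ y) ∈ (tmul (x ⊓ x') (y ⊓ y') : LocalePullback f g) := hE (s, t) hst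
    rwa [inf_eq_left.2 hs, inf_eq_left.2 ht] at h
  · rw [tmul_le, mem_inf]
    exact ⟨SupTensor.lower _ inf_le_left inf_le_left (mem_tmul x y),
      SupTensor.lower _ inf_le_right inf_le_right (mem_tmul x' y')⟩

/-- The inverse image `x ↦ x ⊗ 1` of the first projection `L ×_B M → L`. -/
def fst (f : FrameHom B L) (g : FrameHom B M) : FrameHom L (LocalePullback f g) where
  toFun x := tmul x ⊤
  map_inf' x x' := by rw [tmul_inf_tmul, inf_idem]
  map_top' := top_le_iff.1 fun z _ => SupTensor.lower _ le_top le_top (mem_tmul _ _)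
  map_sSup' s := by
    apply le_antisymm
    · rw [tmul_le]
      exact SupTensor.sSup_left _ _ _ fun x hx => tmul_le.1 (le_sSup ⟨x, hx, rfl⟩)
    · refine sSup_le ?_
      rintro _ ⟨x, hx, rfl⟩
      exact tmul_le.2 (SupTensor.lower _ (le_sSup hx) le_rfl (mem_tmul _ _))

/-- The inverse image `y ↦ 1 ⊗ y` of the second projection `L ×_B M → M`. -/
def snd (f : FrameHom B L) (g : FrameHom B M) : FrameHom M (LocalePullback f g) where
  toFun y := tmul ⊤ y
  map_inf' y y' := by rw [tmul_inf_tmul, inf_idem]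
  map_top' := top_le_iff.1 fun z _ => SupTensor.lower _ le_top le_top (mem_tmul _ _)
  map_sSup' s := by
    apply le_antisymm
    · rw [tmul_le]
      exact SupTensor.sSup_right _ _ _ fun y hy => tmul_le.1 (le_sSup ⟨y, hy, rfl⟩)
    · refine sSup_le ?_
      rintro _ ⟨y, hy, rfl⟩
      exact tmul_le.2 (SupTensor.lower _ le_rfl (le_sSup hy) (mem_tmul _ _))

theorem fst_inf_snd (x : L) (y : M) : fst f g x ⊓ snd f g y = tmul x y := by
  change (tmul x ⊤ ⊓ tmul ⊤ y : LocalePullback f g) = _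
  rw [tmul_inf_tmul, inf_top_eq, top_inf_eq]

theorem fst_comp : (fst f g).comp f = (snd f g).comp g := by
  ext1 b
  change (tmul (f b) ⊤ : LocalePullback f g) = tmul ⊤ (g b)
  apply le_antisymm
  · rw [tmul_le]
    have h := (SupTensor.balanced (tmul ⊤ (g b) : LocalePullback f g) ⊤ b ⊤).2
    simp only [top_inf_eq, inf_top_eq] at h
    exact h (mem_tmul _ _)
  · rw [tmul_le]
    have h := (SupTensor.balanced (tmul (f b) ⊤ : LocalePullback f g) ⊤ b ⊤).1
    simp only [top_inf_eq, inf_top_eq] at h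
    exact h (mem_tmul _ _)

variable {Z : Type u} [Order.Frame Z]

/-- The right adjoint of the copairing. -/
def copairAdjoint (a : FrameHom L Z) (b : FrameHom M Z) (h : a.comp f = b.comp g) (z : Z) :
    LocalePullback f g where
  carrier := {w | a w.1 ⊓ b w.2 ≤ z}
  lower' := fun hx hy hw =>
    (inf_le_inf (OrderHomClass.mono a hx) (OrderHomClass.mono b hy)).trans hw
  sSup_left' := fun s y hs => by
    change a (sSup s) ⊓ b y ≤ z
    rw [map_sSup, sSup_inf_eq]
    refine iSup₂_le ?_
    rintro _ ⟨x, hx, rfl⟩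
    exact hs x hx
  sSup_right' := fun x s hs => by
    change a x ⊓ b (sSup s) ≤ z
    rw [map_sSup, inf_sSup_eq]
    refine iSup₂_le ?_
    rintro _ ⟨y, hy, rfl⟩
    exact hs y hy
  balanced' := fun x t y => by
    have ht : a (f t) = b (g t) := DFunLike.congr_fun h t
    change a (x ⊓ f t) ⊓ b y ≤ z ↔ a x ⊓ b (g t ⊓ y) ≤ z
    rw [map_inf, map_inf, ht, inf_assoc]

/-- The inverse image of the pairing `Z → L ×_B M` of two maps of locales `Z → L` and `Z → M`
(with inverse images `a` and `b`) that agree over `B`. -/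
def copair (a : FrameHom L Z) (b : FrameHom M Z) (h : a.comp f = b.comp g) :
    FrameHom (LocalePullback f g) Z where
  toFun D := ⨆ w : L × M, ⨆ _ : w ∈ D, a w.1 ⊓ b w.2
  map_inf' D E := by
    apply le_antisymm
    · refine iSup₂_le fun w hw => ?_
      rw [mem_inf] at hw
      exact le_inf (le_iSup₂ (f := fun (w : L × M) (_ : w ∈ D) => a w.1 ⊓ b w.2) w hw.1)
        (le_iSup₂ (f := fun (w : L × M) (_ : w ∈ E) => a w.1 ⊓ b w.2) w hw.2)
    · rw [iSup₂_inf_eq]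
      refine iSup₂_le fun w hw => ?_
      rw [inf_iSup₂_eq]
      refine iSup₂_le fun v hv => ?_
      refine le_trans ?_ (le_iSup₂ (f := fun (w : L × M) (_ : w ∈ D ⊓ E) => a w.1 ⊓ b w.2)
        (w.1 ⊓ v.1, w.2 ⊓ v.2) (mem_inf.2 ⟨D.lower inf_le_left inf_le_left hw,
          E.lower inf_le_right inf_le_right hv⟩))
      rw [map_inf, map_inf, inf_inf_inf_comm]
  map_top' := by
    refine top_le_iff.1 (le_trans ?_ (le_iSup₂
      (f := fun (w : L × M) (_ : w ∈ (⊤ : LocalePullback f g)) => a w.1 ⊓ b w.2)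
      (⊤, ⊤) (mem_top _)))
    simp
  map_sSup' S := by
    have gc : GaloisConnection
        (fun D : LocalePullback f g => ⨆ w : L × M, ⨆ _ : w ∈ D, a w.1 ⊓ b w.2)
        (copairAdjoint a b h) := fun D z => by
      simp only [iSup_le_iff]
      exact Iff.rfl
    rw [sSup_image]
    exact gc.l_sSup

theorem copair_tmul (a : FrameHom L Z) (b : FrameHom M Z) (h : a.comp f = b.comp g)
    (x : L) (y : M) : copair a b h (tmul x y) = a x ⊓ b y := by
  apply le_antisymm
  · refine iSup₂_le fun w hw => ?_
    have hle : (tmul x y : LocalePullback f g) ≤ copairAdjoint a b h (a x ⊓ b y) :=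
      tmul_le.2 (le_refl (a x ⊓ b y))
    exact hle w hw
  · exact le_iSup₂ (f := fun (w : L × M) (_ : w ∈ (tmul x y : LocalePullback f g)) =>
      a w.1 ⊓ b w.2) (x, y) (mem_tmul x y)

theorem copair_comp_fst (a : FrameHom L Z) (b : FrameHom M Z) (h : a.comp f = b.comp g) :
    (copair a b h).comp (fst f g) = a := by
  ext1 x
  change copair a b h (tmul x ⊤) = a x
  rw [copair_tmul, map_top, inf_top_eq]

theorem copair_comp_snd (a : FrameHom L Z) (b : FrameHom M Z) (h : a.comp f = b.comp g) :
    (copair a b h).comp (snd f g) = b := by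
  ext1 y
  change copair a b h (tmul ⊤ y) = b y
  rw [copair_tmul, map_top, top_inf_eq]

/-- Every element of `L ⊗_B M` is the join of the pure tensors below it. -/
theorem eq_sSup_tmul (D : LocalePullback f g) :
    D = sSup {E | ∃ w ∈ D, E = tmul w.1 w.2} := by
  apply le_antisymm
  · intro w hw
    exact tmul_le.1 (le_sSup ⟨w, hw, rfl⟩)
  · refine sSup_le ?_
    rintro _ ⟨w, hw, rfl⟩
    exact tmul_le.2 hw

/-- Together with `fst_comp`, this is the universal property of the pullback of locales. -/
theorem existsUnique_copair (a : FrameHom L Z) (b : FrameHom M Z) (h : a.comp f = b.comp g) :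
    ∃! k : FrameHom (LocalePullback f g) Z, k.comp (fst f g) = a ∧ k.comp (snd f g) = b := by
  refine ⟨copair a b h, ⟨copair_comp_fst a b h, copair_comp_snd a b h⟩, ?_⟩
  rintro k ⟨rfl, rfl⟩
  ext1 D
  rw [eq_sSup_tmul D, map_sSup, map_sSup]
  congr 1
  refine Set.image_congr ?_
  rintro _ ⟨w, -, rfl⟩
  rw [copair_tmul, ← fst_inf_snd, map_inf]
  rfl

end LocalePullback

end Pullback

/-! ## Localic groupoids -/

open LocalePullback

/-- The structure maps of a localic groupoid with locale of objects `G₀` and locale of arrows `G₁`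
(all given by their inverse images), with their domains and ranges. The locale `G₂` of composable
pairs consists of the `(g, h)` with `r g = d h`, and `d (gh) = d g`, `r (gh) = r h`. -/
structure LocalicGroupoidData (G₀ G₁ : Type u) [Order.Frame G₀] [Order.Frame G₁] where
  /-- the domain map `G₁ → G₀` -/
  d : FrameHom G₀ G₁
  /-- the range map `G₁ → G₀` -/
  r : FrameHom G₀ G₁
  /-- the unit map `G₀ → G₁` -/
  u : FrameHom G₁ G₀
  /-- the inversion map `G₁ → G₁` -/
  i : FrameHom G₁ G₁
  /-- the multiplication map `G₂ → G₁` -/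
  m : FrameHom G₁ (LocalePullback r d)
  u_d : u.comp d = FrameHom.id G₀
  u_r : u.comp r = FrameHom.id G₀
  i_d : i.comp d = r
  i_r : i.comp r = d
  m_d : m.comp d = (fst r d).comp d
  m_r : m.comp r = (snd r d).comp r

namespace LocalicGroupoidData

variable {G₀ G₁ : Type u} [Order.Frame G₀] [Order.Frame G₁] (G : LocalicGroupoidData G₀ G₁)

/-- The product `g h = m ∘ ⟨g, h⟩ : Z → G₁` of generalized points `g, h : Z → G₁`
with `r ∘ g = d ∘ h`. -/
def pmul {Z : Type u} [Order.Frame Z] (g h : FrameHom G₁ Z) (hgh : g.comp G.r = h.comp G.d) :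
    FrameHom G₁ Z := (copair g h hgh).comp G.m

variable {G}

theorem pmul_d {Z : Type u} [Order.Frame Z] {g h : FrameHom G₁ Z}
    (hgh : g.comp G.r = h.comp G.d) : (G.pmul g h hgh).comp G.d = g.comp G.d := by
  rw [pmul, FrameHom.comp_assoc, G.m_d, ← FrameHom.comp_assoc, copair_comp_fst]

theorem pmul_r {Z : Type u} [Order.Frame Z] {g h : FrameHom G₁ Z}
    (hgh : g.comp G.r = h.comp G.d) : (G.pmul g h hgh).comp G.r = h.comp G.r := by
  rw [pmul, FrameHom.comp_assoc, G.m_r, ← FrameHom.comp_assoc, copair_comp_snd]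

end LocalicGroupoidData

/-- A localic groupoid, i.e. an internal groupoid in the category of locales. The associativity law
is stated for all triples of composable generalized points `Z → G₁`; the generic triple, with
`Z = G₁ ×_{G₀} G₁ ×_{G₀} G₁`, gives the usual diagram. -/
structure LocalicGroupoid (G₀ G₁ : Type u) [Order.Frame G₀] [Order.Frame G₁] extends
    LocalicGroupoidData G₀ G₁ where
  mul_assoc : ∀ (Z : Type u) [Order.Frame Z] (g h k : FrameHom G₁ Z)
    (hgh : g.comp r = h.comp d) (hhk : h.comp r = k.comp d),
    toLocalicGroupoidData.pmul (toLocalicGroupoidData.pmul g h hgh) k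
        ((LocalicGroupoidData.pmul_r (G := toLocalicGroupoidData) hgh).trans hhk) =
      toLocalicGroupoidData.pmul g (toLocalicGroupoidData.pmul h k hhk)
        (hgh.trans (LocalicGroupoidData.pmul_d (G := toLocalicGroupoidData) hhk).symm)
  /-- `u(d(g)) g = g` -/
  unit_mul : toLocalicGroupoidData.pmul (d.comp u) (FrameHom.id G₁)
    (by rw [FrameHom.comp_assoc, u_r, FrameHom.comp_id, FrameHom.id_comp]) = FrameHom.id G₁
  /-- `g u(r(g)) = g` -/
  mul_unit : toLocalicGroupoidData.pmul (FrameHom.id G₁) (r.comp u)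
    (by rw [FrameHom.comp_assoc, u_d, FrameHom.comp_id, FrameHom.id_comp]) = FrameHom.id G₁
  /-- `g g⁻¹ = u(d(g))` -/
  mul_inv : toLocalicGroupoidData.pmul (FrameHom.id G₁) i
    (by rw [i_d, FrameHom.id_comp]) = d.comp u
  /-- `g⁻¹ g = u(r(g))` -/
  inv_mul : toLocalicGroupoidData.pmul i (FrameHom.id G₁)
    (by rw [i_r, FrameHom.id_comp]) = r.comp u

namespace LocalicGroupoid

variable {G₀ G₁ : Type u} [Order.Frame G₀] [Order.Frame G₁] (G : LocalicGroupoid G₀ G₁)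

/-- A localic groupoid is open if its domain map is open. -/
def IsOpen : Prop := IsOpenLocaleMap G.d

/-! ### The quantale `𝒪(G)` of a groupoid, based on `A = G₀`, with underlying frame `Q = G₁` -/

/-- The multiplication `q q' = m_!(q ⊗ q')` of `𝒪(G)`. -/
def qmul (q q' : G₁) : G₁ := directImage G.m (SupTensor.tmul q q')

/-- The involution `q ↦ q* = i_!(q)` of `𝒪(G)`. -/
def qstar (q : G₁) : G₁ := directImage G.i q

/-- The left action of `A = G₀` on `𝒪(G)`. -/
def qlact (a : G₀) (q : G₁) : G₁ := G.d a ⊓ q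

/-- The right action of `A = G₀` on `𝒪(G)`. -/
def qract (q : G₁) (a : G₀) : G₁ := q ⊓ G.r a

/-- The support `d_!` of `𝒪(G)`. -/
def qsupp (q : G₁) : G₀ := directImage G.d q

/-- The frame homomorphism `υ = u^*` of `𝒪(G)`. -/
def qunit : FrameHom G₁ G₀ := G.u

end LocalicGroupoid

/-! ## Groupoid actions and principal bundles -/

/-- The anchor map and the action of a (left) `G`-locale `X` (given by their inverse images), with
the compatibility `p (g x) = d g`. The locale `G₁ ×_{G₀} X` consists of the pairs `(g, x)`
with `r g = p x`. -/
structure GLocaleData {G₀ G₁ : Type u} [Order.Frame G₀] [Order.Frame G₁]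
    (G : LocalicGroupoid G₀ G₁) (X : Type u) [Order.Frame X] where
  /-- the anchor map `X → G₀` -/
  p : FrameHom G₀ X
  /-- the action `G₁ ×_{G₀} X → X` -/
  act : FrameHom X (LocalePullback G.r p)
  act_p : act.comp p = (fst G.r p).comp G.d

namespace GLocaleData

variable {G₀ G₁ : Type u} [Order.Frame G₀] [Order.Frame G₁] {G : LocalicGroupoid G₀ G₁}
  {X : Type u} [Order.Frame X]

/-- The generalized point `g x : Z → X` for generalized points `g : Z → G₁` and `x : Z → X`
with `r ∘ g = p ∘ x`. -/
def pact (S : GLocaleData G X) {Z : Type u} [Order.Frame Z] (g : FrameHom G₁ Z)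
    (x : FrameHom X Z) (h : g.comp G.r = x.comp S.p) : FrameHom X Z :=
  (copair g x h).comp S.act

theorem pact_p {S : GLocaleData G X} {Z : Type u} [Order.Frame Z] {g : FrameHom G₁ Z}
    {x : FrameHom X Z} (h : g.comp G.r = x.comp S.p) :
    (S.pact g x h).comp S.p = g.comp G.d := by
  rw [pact, FrameHom.comp_assoc, S.act_p, ← FrameHom.comp_assoc, copair_comp_fst]

end GLocaleData

/-- A (left) `G`-locale structure on the locale `X`. -/
structure GLocale {G₀ G₁ : Type u} [Order.Frame G₀] [Order.Frame G₁]
    (G : LocalicGroupoid G₀ G₁) (X : Type u) [Order.Frame X] extends GLocaleData G X where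
  /-- `(g h) x = g (h x)`, for all composable generalized points -/
  act_assoc : ∀ (Z : Type u) [Order.Frame Z] (g h : FrameHom G₁ Z) (x : FrameHom X Z)
    (hgh : g.comp G.r = h.comp G.d) (hhx : h.comp G.r = x.comp p),
    toGLocaleData.pact (G.pmul g h hgh) x ((LocalicGroupoidData.pmul_r hgh).trans hhx) =
      toGLocaleData.pact g (toGLocaleData.pact h x hhx)
        (hgh.trans (GLocaleData.pact_p (S := toGLocaleData) hhx).symm)
  /-- `u(p(x)) x = x` -/
  unit_act : toGLocaleData.pact (p.comp G.u) (FrameHom.id X)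
    (by rw [FrameHom.comp_assoc, G.u_r, FrameHom.comp_id, FrameHom.id_comp]) = FrameHom.id X

/-- A fully open principal `G`-bundle structure over `M` on the locale `X`: a principal `G`-bundle
`(X, act, p)` over `M`, with projection `π : X → M`, whose anchor map `p` is an open surjection. -/
structure FullyOpenPrincipalBundle {G₀ G₁ : Type u} [Order.Frame G₀] [Order.Frame G₁]
    (G : LocalicGroupoid G₀ G₁) (M X : Type u) [Order.Frame M] [Order.Frame X] extends
    GLocale G X where
  /-- the projection `X → M` -/
  π : FrameHom M X
  /-- `π (g x) = π x` -/
  act_π : act.comp π = (snd G.r p).comp π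
  π_isOpen : IsOpenLocaleMap π
  π_surj : IsLocaleSurjection π
  /-- the pairing map `⟨act, π₂⟩ : G₁ ×_{G₀} X → X ×_M X` is an isomorphism of locales -/
  pairing_bijective : Function.Bijective (copair act (snd G.r p) act_π : FrameHom
    (LocalePullback π π) (LocalePullback G.r p))
  p_isOpen : IsOpenLocaleMap p
  p_surj : IsLocaleSurjection p

namespace FullyOpenPrincipalBundle

variable {G₀ G₁ : Type u} [Order.Frame G₀] [Order.Frame G₁] {G : LocalicGroupoid G₀ G₁}
  {M X : Type u} [Order.Frame M] [Order.Frame X]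

/-- The inverse image of the map `θ : X ×_M X → G₁`, the first component of the inverse of the
pairing map; thus `θ(x, x') x' = x`. -/
noncomputable def θ (B : FullyOpenPrincipalBundle G M X) :
    FrameHom G₁ (LocalePullback B.π B.π) :=
  (FrameHom.inverse _ B.pairing_bijective).comp (fst G.r B.p)

end FullyOpenPrincipalBundle

/-! ## Principal `𝒪(G)`-locales -/

/-- The operations of a principal `𝒪(G)`-locale over `M` on the locale `X`; here `Q = 𝒪(G)` has
underlying frame `G₁` and base locale `A = G₀`. -/
structure PrincipalLocaleData {G₀ G₁ : Type u} [Order.Frame G₀] [Order.Frame G₁]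
    (G : LocalicGroupoid G₀ G₁) (M X : Type u) [Order.Frame M] [Order.Frame X] where
  /-- the action `(a, x) ↦ ᵃx` of the base locale `A` -/
  lact : G₀ → X → X
  /-- the action `(q, x) ↦ q · x` of `Q` -/
  smul : G₁ → X → X
  /-- the inner product -/
  inner : X → X → G₁
  /-- the support -/
  supp : X → G₀
  /-- the map of locales `X → M` (its inverse image) -/
  proj : FrameHom M X

namespace PrincipalLocaleData

variable {G₀ G₁ : Type u} [Order.Frame G₀] [Order.Frame G₁] {G : LocalicGroupoid G₀ G₁}
  {M X : Type u} [Order.Frame M] [Order.Frame X]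

/-- `X` is a `Q`-module. -/
structure IsModule (S : PrincipalLocaleData G M X) : Prop where
  smul_sSup : ∀ (q : G₁) (s : Set X), S.smul q (sSup s) = sSup ((fun x => S.smul q x) '' s)
  sSup_smul : ∀ (s : Set G₁) (x : X), S.smul (sSup s) x = sSup ((fun q => S.smul q x) '' s)
  mul_smul : ∀ (q q' : G₁) (x : X), S.smul (G.qmul q q') x = S.smul q (S.smul q' x)
  lact_sSup : ∀ (a : G₀) (s : Set X), S.lact a (sSup s) = sSup ((fun x => S.lact a x) '' s)
  sSup_lact : ∀ (s : Set G₀) (x : X), S.lact (sSup s) x = sSup ((fun a => S.lact a x) '' s)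
  inf_lact : ∀ (a b : G₀) (x : X), S.lact (a ⊓ b) x = S.lact a (S.lact b x)
  top_lact : ∀ x : X, S.lact ⊤ x = x
  lact_smul : ∀ (a : G₀) (q : G₁) (x : X), S.smul (G.qlact a q) x = S.lact a (S.smul q x)
  ract_smul : ∀ (q : G₁) (a : G₀) (x : X), S.smul (G.qract q a) x = S.smul q (S.lact a x)
  lact_inf : ∀ (a : G₀) (x y : X), S.lact a (x ⊓ y) = S.lact a x ⊓ y

/-- `X` is a pre-Hilbert `Q`-module. -/
structure IsPreHilbert (S : PrincipalLocaleData G M X) : Prop extends S.IsModule where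
  inner_smul : ∀ (q : G₁) (x y : X), S.inner (S.smul q x) y = G.qmul q (S.inner x y)
  inner_lact : ∀ (a : G₀) (x : X), G.qlact a (S.inner x ⊤) = S.inner (S.lact a x) ⊤
  inner_sSup : ∀ (s : Set X) (y : X), S.inner (sSup s) y = sSup ((fun x => S.inner x y) '' s)
  inner_star : ∀ x y : X, S.inner x y = G.qstar (S.inner y x)

/-- `X` is a supported `Q`-module. -/
structure IsSupported (S : PrincipalLocaleData G M X) : Prop extends S.IsPreHilbert where
  supp_mono : Monotone S.supp
  supp_top : S.supp ⊤ = ⊤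
  supp_le : ∀ x : X, S.lact (S.supp x) ⊤ ≤ S.smul (S.inner x x) ⊤
  supp_lact : ∀ x : X, S.lact (S.supp x) x = x

/-- `X` is a stably supported `Q`-module. -/
structure IsStablySupported (S : PrincipalLocaleData G M X) : Prop extends S.IsSupported where
  supp_smul_le : ∀ (q : G₁) (x : X), S.supp (S.smul q x) ≤ G.qsupp q

/-- The tensor product `Q ⊗_A X`. -/
abbrev Tensor (S : PrincipalLocaleData G M X) : Type u := SupTensor G.qract S.lact

/-- The mapping `α_* : X → Q ⊗_A X`, `α_*(x) = ⋁ {q ⊗ y | q · y ≤ x}`. -/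
def αStar (S : PrincipalLocaleData G M X) (x : X) : S.Tensor :=
  sSup {t | ∃ q y, S.smul q y ≤ x ∧ t = SupTensor.tmul q y}

/-- `X` is a `Q`-locale (axioms Q1 and Q2). -/
structure IsQLocale (S : PrincipalLocaleData G M X) : Prop extends S.IsStablySupported where
  Q1 : ∀ s : Set X, S.αStar (sSup s) = sSup (S.αStar '' s)
  Q2 : ∀ x : X, sSup {z | ∃ q y, S.smul q y ≤ x ∧ z = S.lact (G.qunit q) y} = x

/-- `X` is a principal `Q`-locale over `M` (axioms P1, P2 and P3). The `M`-support is the direct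
image of the map of locales `X → M`. -/
structure IsPrincipal (S : PrincipalLocaleData G M X) : Prop extends S.IsQLocale where
  P1 : IsOpenLocaleMap S.proj ∧ directImage S.proj ⊤ = ⊤
  P2 : ∀ (q : G₁) (x : X), directImage S.proj (S.smul q x) =
    directImage S.proj (S.lact (G.qsupp (G.qstar q)) x)
  P3 : ∃ φ : LocalePullback S.proj S.proj ≃o S.Tensor, ∀ x y : X,
    φ (SupTensor.tmul x y) =
      sSup {t | ∃ q z, S.smul q z ≤ x ∧ t = SupTensor.tmul q (z ⊓ y)}

end PrincipalLocaleData

/-- The principal `𝒪(G)`-locale structures over `M` on the locale `X`. -/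
def PrincipalLocale {G₀ G₁ : Type u} [Order.Frame G₀] [Order.Frame G₁]
    (G : LocalicGroupoid G₀ G₁) (M X : Type u) [Order.Frame M] [Order.Frame X] : Type u :=
  {S : PrincipalLocaleData G M X // S.IsPrincipal}

/-- Two principal `𝒪(G)`-locale structures over `M` on `X` are identified when they differ at most
in the choice of the inner product, i.e. when the identity of `X` is an isomorphism between them in
the category of `𝒪(G)`-locales (whose morphisms are the frame homomorphisms that preserve both
actions and the support) over `M`. -/
instance PrincipalLocale.setoid {G₀ G₁ : Type u} [Order.Frame G₀] [Order.Frame G₁]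
    (G : LocalicGroupoid G₀ G₁) (M X : Type u) [Order.Frame M] [Order.Frame X] :
    Setoid (PrincipalLocale G M X) where
  r S T := S.1.lact = T.1.lact ∧ S.1.smul = T.1.smul ∧ S.1.supp = T.1.supp ∧ S.1.proj = T.1.proj
  iseqv :=
    { refl := fun _ => ⟨rfl, rfl, rfl, rfl⟩
      symm := fun h => ⟨h.1.symm, h.2.1.symm, h.2.2.1.symm, h.2.2.2.symm⟩
      trans := fun h k => ⟨h.1.trans k.1, h.2.1.trans k.2.1, h.2.2.1.trans k.2.2.1,
        h.2.2.2.trans k.2.2.2⟩ }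

/-- The operations on `𝒪(X)` for a fully open principal `G`-bundle `X` over `M`:
`ᵃx = p^*(a) ∧ x`, `q · x = act_!(q ⊗ x)`, `⟨x, y⟩ = θ_!(x ⊗ y)`, with support `p_!`, and with
projection `π` (so that the `M`-support is `π_!`). -/
noncomputable def FullyOpenPrincipalBundle.opens {G₀ G₁ : Type u} [Order.Frame G₀]
    [Order.Frame G₁] {G : LocalicGroupoid G₀ G₁} {M X : Type u} [Order.Frame M] [Order.Frame X]
    (B : FullyOpenPrincipalBundle G M X) : PrincipalLocaleData G M X where
  lact a x := B.p a ⊓ x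
  smul q x := directImage B.act (SupTensor.tmul q x)
  inner x y := directImage B.θ (SupTensor.tmul x y)
  supp := directImage B.p
  proj := B.π

/-!
A principal bundle can be recovered from its operations because every map involved is open. The
inverse image `act^*` of the action is the right adjoint of `q ⊗ x ↦ q · x`, so that
`(q, x) ∈ act^* y ↔ q · x ≤ y`, while `p^* a = ᵃ1`, and `π` is part of both structures.

Openness of the action (`GLocale.isOpenLocaleMap_act`) holds because `(g, x) ↦ (g, g x)` is an
isomorphism `G₁ ×_{G₀} X ≅ G₁ ×_{d, p} X` which turns the action into the pullback of `d` along `p`;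
for `X = G₁` this gives openness of `m`. The division map `θ` is open, being the composite of
an isomorphism with a pullback of the open map `p`.

From bundles to principal `𝒪(G)`-locales: an identity between maps of locales such as
`(g h) x = g (h x)` or `θ(g x, y) = g θ(x, y)` becomes the corresponding identity between direct
images, `(q q') · x = q · (q' · x)` or `⟨q · x, y⟩ = q ⟨x, y⟩`. The principle is
`LocalePullback.directImage_assoc`, which rests on the Beck–Chevalley condition
`LocalePullback.mem_copair_left`. The identities for `θ` are proved on generalized points from
`θ(x, y) y = x` and the freeness of the action. The isomorphism in P3 is the pairing map.

From principal `𝒪(G)`-locales to bundles: the action of `A` has the form `ᵃx = p^* a ∧ x`. In a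
stably supported module the support is left adjoint to `p^*`, and `ς x = d_! ⟨x, 1⟩` gives the
Frobenius condition; hence `p` is an open surjection and `ς = p_!`. The map `α_*` is a right adjoint,
so Q1 makes it a frame homomorphism, and it is the inverse image of the action: associativity on
generalized points comes from the module law, the unit law is Q2, invariance of `π` comes from P2,
and P3 says that the pairing map is an isomorphism. The bundle is built from the two actions and `π`
alone, so structures that differ only in the inner product give the same bundle.
-/

/-! ### Open maps of locales -/

section OpenMaps

variable {L M N : Type u} [Order.Frame L] [Order.Frame M] [Order.Frame N]

theorem directImage_eq_of_gc {f : FrameHom M L} {l : L → M} (h : GaloisConnection l f) :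
    directImage f = l := by
  funext a
  exact le_antisymm (sInf_le (h.le_u_l a)) (le_sInf fun b hb => h.l_le hb)

theorem IsOpenLocaleMap.of_gc {f : FrameHom M L} {l : L → M} (h : GaloisConnection l f)
    (hl : ∀ a b, l a ⊓ b ≤ l (a ⊓ f b)) : IsOpenLocaleMap f := by
  rw [IsOpenLocaleMap, directImage_eq_of_gc h]
  exact ⟨h, fun a b => le_antisymm
    (le_inf (h.monotone_l inf_le_left) (h.l_le inf_le_right)) (hl a b)⟩

theorem IsOpenLocaleMap.gc {f : FrameHom M L} (hf : IsOpenLocaleMap f) :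
    GaloisConnection (directImage f) f := hf.1

theorem IsOpenLocaleMap.directImage_le_iff {f : FrameHom M L} (hf : IsOpenLocaleMap f)
    {a : L} {b : M} : directImage f a ≤ b ↔ a ≤ f b := hf.1 a b

theorem IsOpenLocaleMap.frobenius {f : FrameHom M L} (hf : IsOpenLocaleMap f) (a : L) (b : M) :
    directImage f (a ⊓ f b) = directImage f a ⊓ b := hf.2 a b

theorem IsOpenLocaleMap.directImage_mono {f : FrameHom M L} (hf : IsOpenLocaleMap f) :
    Monotone (directImage f) := hf.gc.monotone_l

theorem IsOpenLocaleMap.directImage_sSup {f : FrameHom M L} (hf : IsOpenLocaleMap f)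
    (s : Set L) : directImage f (sSup s) = sSup (directImage f '' s) := by
  rw [hf.gc.l_sSup, sSup_image]

theorem IsOpenLocaleMap.gc_comp {f : FrameHom M L} {g : FrameHom N M} (hf : IsOpenLocaleMap f)
    (hg : IsOpenLocaleMap g) :
    GaloisConnection (directImage g ∘ directImage f) (f.comp g) := hf.gc.compose hg.gc

theorem IsOpenLocaleMap.comp {f : FrameHom M L} {g : FrameHom N M} (hf : IsOpenLocaleMap f)
    (hg : IsOpenLocaleMap g) : IsOpenLocaleMap (f.comp g) :=
  .of_gc (hf.gc_comp hg) fun a b => by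
    change directImage g (directImage f a) ⊓ b ≤ directImage g (directImage f (a ⊓ f (g b)))
    rw [hf.frobenius, hg.frobenius]

theorem IsOpenLocaleMap.directImage_comp {f : FrameHom M L} {g : FrameHom N M}
    (hf : IsOpenLocaleMap f) (hg : IsOpenLocaleMap g) (a : L) :
    directImage (f.comp g) a = directImage g (directImage f a) :=
  congrFun (directImage_eq_of_gc (hf.gc_comp hg)) a

theorem gc_of_inverse {f : FrameHom M L} {k : FrameHom L M} (hfk : f.comp k = FrameHom.id L)
    (hkf : k.comp f = FrameHom.id M) : GaloisConnection k f := fun a b => by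
  have h₁ : f (k a) = a := DFunLike.congr_fun hfk a
  have h₂ : k (f b) = b := DFunLike.congr_fun hkf b
  constructor
  · intro h
    rw [← h₁]
    exact OrderHomClass.mono f h
  · intro h
    rw [← h₂]
    exact OrderHomClass.mono k h

theorem isOpenLocaleMap_of_inverse {f : FrameHom M L} {k : FrameHom L M}
    (hfk : f.comp k = FrameHom.id L) (hkf : k.comp f = FrameHom.id M) : IsOpenLocaleMap f :=
  .of_gc (gc_of_inverse hfk hkf) fun a b => by
    have h₂ : k (f b) = b := DFunLike.congr_fun hkf b
    rw [map_inf, h₂]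

theorem IsOpenLocaleMap.directImage_top {f : FrameHom M L} (hf : IsOpenLocaleMap f)
    (hf' : IsLocaleSurjection f) : directImage f ⊤ = ⊤ := by
  apply hf'
  rw [map_top]
  exact top_le_iff.1 (hf.gc.le_u_l ⊤)

theorem IsOpenLocaleMap.isLocaleSurjection {f : FrameHom M L} (hf : IsOpenLocaleMap f)
    (hf' : directImage f ⊤ = ⊤) : IsLocaleSurjection f := by
  have h : ∀ b, directImage f (f b) = b := fun b => by
    have := hf.frobenius ⊤ b
    rwa [top_inf_eq, hf', top_inf_eq] at this
  intro a b hab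
  rw [← h a, ← h b, hab]

theorem FrameHom.inverse_comp (f : FrameHom M L) (hf : Function.Bijective f) :
    (f.inverse hf).comp f = FrameHom.id M := by
  ext1 b
  exact (f.orderIsoOfBijective hf).symm_apply_apply b

theorem FrameHom.comp_inverse (f : FrameHom M L) (hf : Function.Bijective f) :
    f.comp (f.inverse hf) = FrameHom.id L := by
  ext1 a
  exact (f.orderIsoOfBijective hf).apply_symm_apply a

end OpenMaps

/-! ### Pure tensors -/

namespace SupTensor

variable {L M A : Type u} [CompleteLattice L] [CompleteLattice M] {ρ : L → A → L} {σ : A → M → M}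

theorem tmul_sSup_left (s : Set L) (y : M) :
    (tmul (sSup s) y : SupTensor ρ σ) = sSup ((fun x => tmul x y) '' s) := by
  apply le_antisymm
  · exact tmul_le.2 (sSup_left _ _ _ fun x hx => tmul_le.1 (le_sSup ⟨x, hx, rfl⟩))
  · refine sSup_le ?_
    rintro _ ⟨x, hx, rfl⟩
    exact tmul_le.2 (lower _ (le_sSup hx) le_rfl (mem_tmul _ _))

theorem tmul_sSup_right (x : L) (s : Set M) :
    (tmul x (sSup s) : SupTensor ρ σ) = sSup ((fun y => tmul x y) '' s) := by
  apply le_antisymm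
  · exact tmul_le.2 (sSup_right _ _ _ fun y hy => tmul_le.1 (le_sSup ⟨y, hy, rfl⟩))
  · refine sSup_le ?_
    rintro _ ⟨y, hy, rfl⟩
    exact tmul_le.2 (lower _ le_rfl (le_sSup hy) (mem_tmul _ _))

theorem tmul_balanced (x : L) (a : A) (y : M) :
    (tmul (ρ x a) y : SupTensor ρ σ) = tmul x (σ a y) :=
  le_antisymm (tmul_le.2 ((balanced _ x a y).2 (mem_tmul _ _)))
    (tmul_le.2 ((balanced _ x a y).1 (mem_tmul _ _)))

end SupTensor

/-! ### Pullbacks of locales and base change -/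

namespace LocalePullback

open SupTensor

variable {B L M Z : Type u} [Order.Frame B] [Order.Frame L] [Order.Frame M] [Order.Frame Z]
  {f : FrameHom B L} {g : FrameHom B M}

theorem hom_ext {k k' : FrameHom (LocalePullback f g) Z}
    (h₁ : k.comp (fst f g) = k'.comp (fst f g)) (h₂ : k.comp (snd f g) = k'.comp (snd f g)) :
    k = k' :=
  (existsUnique_copair (k'.comp (fst f g)) (k'.comp (snd f g))
    (by rw [FrameHom.comp_assoc, FrameHom.comp_assoc, fst_comp])).unique ⟨h₁, h₂⟩ ⟨rfl, rfl⟩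

theorem copair_congr {a a' : FrameHom L Z} {b b' : FrameHom M Z} (ha : a = a') (hb : b = b')
    (h : a.comp f = b.comp g) (h' : a'.comp f = b'.comp g) : copair a b h = copair a' b' h' := by
  subst ha hb
  rfl

theorem copair_fst_snd : copair (fst f g) (snd f g) fst_comp = FrameHom.id _ :=
  hom_ext (copair_comp_fst _ _ _) (copair_comp_snd _ _ _)

theorem comp_compatible {Z' : Type u} [Order.Frame Z'] (k : FrameHom Z Z') {a : FrameHom L Z}
    {b : FrameHom M Z} (h : a.comp f = b.comp g) : (k.comp a).comp f = (k.comp b).comp g := by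
  rw [FrameHom.comp_assoc, h, FrameHom.comp_assoc]

theorem comp_copair {Z' : Type u} [Order.Frame Z'] (k : FrameHom Z Z') {a : FrameHom L Z}
    {b : FrameHom M Z} (h : a.comp f = b.comp g) :
    k.comp (copair a b h) = copair (k.comp a) (k.comp b) (comp_compatible k h) := by
  apply hom_ext
  · rw [FrameHom.comp_assoc, copair_comp_fst, copair_comp_fst]
  · rw [FrameHom.comp_assoc, copair_comp_snd, copair_comp_snd]

theorem copair_apply (a : FrameHom L Z) (b : FrameHom M Z) (h : a.comp f = b.comp g)
    (D : LocalePullback f g) : copair a b h D = ⨆ w : L × M, ⨆ _ : w ∈ D, a w.1 ⊓ b w.2 := rfl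

theorem le_copair (a : FrameHom L Z) (b : FrameHom M Z) (h : a.comp f = b.comp g)
    {D : LocalePullback f g} {x : L} {y : M} (hD : (x, y) ∈ D) : a x ⊓ b y ≤ copair a b h D :=
  le_iSup₂ (f := fun (w : L × M) (_ : w ∈ D) => a w.1 ⊓ b w.2) (x, y) hD

theorem copair_le (a : FrameHom L Z) (b : FrameHom M Z) (h : a.comp f = b.comp g)
    {D : LocalePullback f g} {z : Z} (hD : ∀ x y, (x, y) ∈ D → a x ⊓ b y ≤ z) :
    copair a b h D ≤ z :=
  iSup₂_le fun w hw => hD w.1 w.2 hw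

theorem tmul_inf_snd (x : L) (y y' : M) :
    (tmul x y : LocalePullback f g) ⊓ snd f g y' = tmul x (y ⊓ y') := by
  change (tmul x y ⊓ tmul ⊤ y' : LocalePullback f g) = _
  rw [tmul_inf_tmul, inf_top_eq]

theorem sSup_tmul_inf_snd (P : L → M → Prop) (y : M) :
    (sSup {t | ∃ q z, P q z ∧ t = tmul q z} : LocalePullback f g) ⊓ snd f g y =
      sSup {t | ∃ q z, P q z ∧ t = tmul q (z ⊓ y)} := by
  rw [sSup_inf_eq]
  apply le_antisymm
  · refine iSup₂_le ?_
    rintro _ ⟨q, z, h, rfl⟩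
    exact le_sSup ⟨q, z, h, tmul_inf_snd q z y⟩
  · refine sSup_le ?_
    rintro _ ⟨q, z, h, rfl⟩
    rw [← tmul_inf_snd]
    refine le_trans (inf_le_inf_right _ (le_sSup ?_)) sSup_inf_eq.le
    exact ⟨q, z, h, rfl⟩

/-- The inverse image of the isomorphism `M ×_B L → L ×_B M` that exchanges the factors. -/
def swap (f : FrameHom B L) (g : FrameHom B M) :
    FrameHom (LocalePullback f g) (LocalePullback g f) :=
  copair (snd g f) (fst g f) fst_comp.symm

theorem swap_comp_fst : (swap f g).comp (fst f g) = snd g f := copair_comp_fst _ _ _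

theorem swap_comp_snd : (swap f g).comp (snd f g) = fst g f := copair_comp_snd _ _ _

theorem swap_comp_swap : (swap f g).comp (swap g f) = FrameHom.id _ := by
  apply hom_ext
  · rw [FrameHom.comp_assoc, swap_comp_fst, swap_comp_snd, FrameHom.id_comp]
  · rw [FrameHom.comp_assoc, swap_comp_snd, swap_comp_fst, FrameHom.id_comp]

theorem swap_tmul (x : L) (y : M) : swap f g (tmul x y) = tmul y x := by
  rw [swap, copair_tmul, inf_comm, fst_inf_snd]

theorem mem_swap {D : LocalePullback f g} {x : L} {y : M} : (y, x) ∈ swap f g D ↔ (x, y) ∈ D := by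
  rw [← tmul_le, ← tmul_le, ← swap_tmul]
  constructor
  · intro h
    have := OrderHomClass.mono (swap g f) h
    have hs : ∀ E, swap g f (swap f g E) = E := DFunLike.congr_fun swap_comp_swap
    rwa [hs, hs] at this
  · exact fun h => OrderHomClass.mono _ h

/-- For an open `f`, the elements of `L ⊗_B M` below `1 ⊗ y'`, by the condition
`g (f_! x) ∧ y ≤ y'` on pure tensors. -/
def sndAdjoint (hf : IsOpenLocaleMap f) (g : FrameHom B M) (y' : M) : LocalePullback f g where
  carrier := {w | g (directImage f w.1) ⊓ w.2 ≤ y'}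
  lower' := fun hx hy h => (inf_le_inf (OrderHomClass.mono g (hf.directImage_mono hx)) hy).trans h
  sSup_left' := by
    intro s y h
    change g (directImage f (sSup s)) ⊓ y ≤ y'
    rw [hf.directImage_sSup, map_sSup, sSup_inf_eq, Set.image_image]
    refine iSup₂_le ?_
    rintro _ ⟨x, hx, rfl⟩
    exact h x hx
  sSup_right' := by
    intro x s h
    change g (directImage f x) ⊓ sSup s ≤ y'
    rw [inf_sSup_eq]
    exact iSup₂_le h
  balanced' := by
    intro x b y
    change g (directImage f (x ⊓ f b)) ⊓ y ≤ y' ↔ g (directImage f x) ⊓ (g b ⊓ y) ≤ y'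
    rw [hf.frobenius, map_inf, inf_assoc]

theorem snd_eq_sndAdjoint (hf : IsOpenLocaleMap f) (y : M) : snd f g y = sndAdjoint hf g y := by
  apply le_antisymm
  · exact tmul_le.2 (show g (directImage f ⊤) ⊓ y ≤ y from inf_le_right)
  · rintro ⟨x, z⟩ (h : g (directImage f x) ⊓ z ≤ y)
    -- `x ⊗ z = x ⊗ (g (f_! x) ∧ z)`, because `x ≤ f (f_! x)`
    have h₁ := (balanced (snd f g y) x (directImage f x) z).2
      (lower _ le_top h (mem_tmul (⊤ : L) y))
    exact lower _ (le_inf le_rfl (hf.gc.le_u_l x)) le_rfl h₁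

theorem mem_snd (hf : IsOpenLocaleMap f) {x : L} {z y : M} :
    (x, z) ∈ snd f g y ↔ g (directImage f x) ⊓ z ≤ y := by
  rw [snd_eq_sndAdjoint hf]
  rfl

/-- Open maps are stable under pullback. -/
theorem isOpenLocaleMap_snd (hf : IsOpenLocaleMap f) : IsOpenLocaleMap (snd f g) := by
  have gc : GaloisConnection (fun D : LocalePullback f g => ⨆ w : L × M, ⨆ _ : w ∈ D,
      g (directImage f w.1) ⊓ w.2) (snd f g) := fun D y => by
    rw [iSup₂_le_iff, le_def]
    exact forall₂_congr fun w _ => (mem_snd hf).symm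
  refine .of_gc gc fun D y => ?_
  rw [iSup₂_inf_eq]
  refine iSup₂_le fun w hw => ?_
  rw [inf_assoc]
  refine le_iSup₂ (f := fun (w : L × M) (_ : w ∈ D ⊓ snd f g y) =>
    g (directImage f w.1) ⊓ w.2) (w.1, w.2 ⊓ y) (mem_inf.2 ⟨?_, ?_⟩)
  · exact lower _ le_rfl inf_le_left hw
  · exact (mem_snd hf).2 (inf_le_right.trans inf_le_right)

theorem isOpenLocaleMap_swap : IsOpenLocaleMap (swap f g) :=
  isOpenLocaleMap_of_inverse swap_comp_swap swap_comp_swap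

theorem isOpenLocaleMap_fst (hg : IsOpenLocaleMap g) : IsOpenLocaleMap (fst f g) := by
  rw [← swap_comp_snd]
  exact isOpenLocaleMap_swap.comp (isOpenLocaleMap_snd hg)

theorem mem_fst (hg : IsOpenLocaleMap g) {x z : L} {y : M} :
    (z, y) ∈ fst f g x ↔ z ⊓ f (directImage g y) ≤ x := by
  rw [← swap_comp_snd]
  exact mem_swap.trans ((mem_snd hg).trans (by rw [inf_comm]))

section BeckChevalley

variable {L' : Type u} [Order.Frame L'] {f' : FrameHom B L'} {k : FrameHom L' L}

/-- The pairs `(x, y)` with `k_! x ⊗ y ≤ D`. -/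
def pullLeft (hk : IsOpenLocaleMap k) (hkf : k.comp f' = f) (D : LocalePullback f' g) :
    LocalePullback f g where
  carrier := {w | (directImage k w.1, w.2) ∈ D}
  lower' := fun hx hy h => D.lower (hk.directImage_mono hx) hy h
  sSup_left' := by
    intro s y h
    change (directImage k (sSup s), y) ∈ D
    rw [hk.directImage_sSup]
    refine D.sSup_left _ _ ?_
    rintro _ ⟨x, hx, rfl⟩
    exact h x hx
  sSup_right' := fun x s h => D.sSup_right _ s h
  balanced' := by
    intro x b y
    subst hkf
    change (directImage k (x ⊓ k (f' b)), y) ∈ D ↔ (directImage k x, g b ⊓ y) ∈ D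
    rw [hk.frobenius]
    exact D.balanced _ b y

/-- The Beck–Chevalley condition for the map `k × 1 : L ×_B M → L' ×_B M` induced by an open map
`k` over `B`: its direct image sends `x ⊗ y` to `k_! x ⊗ y`. -/
theorem mem_copair_left (hk : IsOpenLocaleMap k) (hkf : k.comp f' = f)
    (h : ((fst f g).comp k).comp f' = (snd f g).comp g) {D : LocalePullback f' g} {x : L} {y : M} :
    (x, y) ∈ copair ((fst f g).comp k) (snd f g) h D ↔ (directImage k x, y) ∈ D := by
  constructor
  · have : copair ((fst f g).comp k) (snd f g) h D ≤ pullLeft hk hkf D := by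
      refine copair_le _ _ _ fun x' y' hD => ?_
      change fst f g (k x') ⊓ snd f g y' ≤ _
      rw [fst_inf_snd, tmul_le]
      exact D.lower (hk.gc.l_u_le x') le_rfl hD
    exact this (x, y)
  · intro hD
    have := le_copair _ _ h hD
    change fst f g (k (directImage k x)) ⊓ snd f g y ≤ _ at this
    rw [fst_inf_snd, tmul_le] at this
    exact lower _ (hk.gc.le_u_l x) le_rfl this

/-- The Beck–Chevalley condition for `1 × k : M ×_B L → M ×_B L'`. -/
theorem mem_copair_right (hk : IsOpenLocaleMap k) (hkf : k.comp f' = f)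
    (h : (fst g f).comp g = ((snd g f).comp k).comp f') {D : LocalePullback g f'} {x : L} {y : M} :
    (y, x) ∈ copair (fst g f) ((snd g f).comp k) h D ↔ (y, directImage k x) ∈ D := by
  have h' : ((fst f g).comp k).comp f' = (snd f g).comp g := by
    rw [FrameHom.comp_assoc, hkf, fst_comp]
  have key : (swap f g).comp (copair ((fst f g).comp k) (snd f g) h') =
      (copair (fst g f) ((snd g f).comp k) h).comp (swap f' g) := by
    apply hom_ext
    · rw [FrameHom.comp_assoc, copair_comp_fst, FrameHom.comp_assoc, swap_comp_fst,
        copair_comp_snd, ← FrameHom.comp_assoc, swap_comp_fst]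
    · rw [FrameHom.comp_assoc, copair_comp_snd, FrameHom.comp_assoc, swap_comp_snd,
        swap_comp_snd, copair_comp_fst]
  have hD : D = swap f' g (swap g f' D) := (DFunLike.congr_fun swap_comp_swap D).symm
  have key' := DFunLike.congr_fun key (swap g f' D)
  change swap f g (copair ((fst f g).comp k) (snd f g) h' (swap g f' D)) =
    copair (fst g f) ((snd g f).comp k) h (swap f' g (swap g f' D)) at key'
  rw [← hD] at key'
  rw [← key', mem_swap, mem_copair_left hk hkf, mem_swap]

end BeckChevalley

/-- If the maps of locales `α : L₁ ×_B L₂ → Y`, `β : Y ×_C L₃ → N`, `γ : L₂ ×_C L₃ → Y'` and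
`δ : L₁ ×_B Y' → N` satisfy `β(α(x₁, x₂), x₃) = δ(x₁, γ(x₂, x₃))`, then so do the operations on
elements given by their direct images. -/
theorem directImage_assoc {B C L₁ L₂ L₃ Y Y' N : Type u} [Order.Frame B] [Order.Frame C]
    [Order.Frame L₁] [Order.Frame L₂] [Order.Frame L₃] [Order.Frame Y] [Order.Frame Y']
    [Order.Frame N] {f : FrameHom B L₁} {g : FrameHom B L₂} {g' : FrameHom C L₂}
    {h : FrameHom C L₃} {e : FrameHom C Y} {e' : FrameHom B Y'}
    {α : FrameHom Y (LocalePullback f g)} {β : FrameHom N (LocalePullback e h)}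
    {γ : FrameHom Y' (LocalePullback g' h)} {δ : FrameHom N (LocalePullback f e')}
    (hα : IsOpenLocaleMap α) (hβ : IsOpenLocaleMap β) (hγ : IsOpenLocaleMap γ)
    (hδ : IsOpenLocaleMap δ)
    (hαe : α.comp e = (snd f g).comp g') (hγe : γ.comp e' = (fst g' h).comp g)
    (H : ∀ (Z : Type u) [Order.Frame Z] (x₁ : FrameHom L₁ Z) (x₂ : FrameHom L₂ Z)
      (x₃ : FrameHom L₃ Z) (h₁₂ : x₁.comp f = x₂.comp g) (h₂₃ : x₂.comp g' = x₃.comp h)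
      (h₁ : ((copair x₁ x₂ h₁₂).comp α).comp e = x₃.comp h)
      (h₃ : x₁.comp f = ((copair x₂ x₃ h₂₃).comp γ).comp e'),
      (copair ((copair x₁ x₂ h₁₂).comp α) x₃ h₁).comp β =
        (copair x₁ ((copair x₂ x₃ h₂₃).comp γ) h₃).comp δ)
    (x : L₁) (y : L₂) (z : L₃) :
    directImage β (tmul (directImage α (tmul x y)) z) =
      directImage δ (tmul x (directImage γ (tmul y z))) := by
  -- the two forms `(L₁ ×_B L₂) ×_C L₃` and `L₁ ×_B (L₂ ×_C L₃)` of the locale of generic triples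
  let g₁ := (snd f g).comp g'
  let g₂ := (fst g' h).comp g
  have c₁ : ((fst g₁ h).comp (fst f g)).comp f = ((fst g₁ h).comp (snd f g)).comp g :=
    comp_compatible _ fst_comp
  have c₂ : ((fst g₁ h).comp (snd f g)).comp g' = (snd g₁ h).comp h := fst_comp (f := g₁)
  have c₃ : (fst f g₂).comp f = ((snd f g₂).comp (fst g' h)).comp g := fst_comp (g := g₂)
  have c₄ : ((snd f g₂).comp (fst g' h)).comp g' = ((snd f g₂).comp (snd g' h)).comp h :=
    comp_compatible _ fst_comp
  have e₁ : copair ((fst g₁ h).comp (fst f g)) ((fst g₁ h).comp (snd f g)) c₁ = fst g₁ h := by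
    rw [← comp_copair _ fst_comp, copair_fst_snd, FrameHom.comp_id]
  have e₂ : copair ((snd f g₂).comp (fst g' h)) ((snd f g₂).comp (snd g' h)) c₄ = snd f g₂ := by
    rw [← comp_copair _ fst_comp, copair_fst_snd, FrameHom.comp_id]
  have A₁ := fun {Z : Type u} [Order.Frame Z] {x₁ : FrameHom L₁ Z} {x₂ : FrameHom L₂ Z}
      {x₃ : FrameHom L₃ Z} (h₁₂ : x₁.comp f = x₂.comp g) (h₂₃ : x₂.comp g' = x₃.comp h) =>
    show ((copair x₁ x₂ h₁₂).comp α).comp e = x₃.comp h by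
      rw [FrameHom.comp_assoc, hαe, ← FrameHom.comp_assoc, copair_comp_snd, h₂₃]
  have A₂ := fun {Z : Type u} [Order.Frame Z] {x₁ : FrameHom L₁ Z} {x₂ : FrameHom L₂ Z}
      {x₃ : FrameHom L₃ Z} (h₁₂ : x₁.comp f = x₂.comp g) (h₂₃ : x₂.comp g' = x₃.comp h) =>
    show x₁.comp f = ((copair x₂ x₃ h₂₃).comp γ).comp e' by
      rw [FrameHom.comp_assoc, hγe, ← FrameHom.comp_assoc, copair_comp_fst, h₁₂]
  have b₁ : ((fst g₁ h).comp α).comp e = (snd g₁ h).comp h := by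
    rw [FrameHom.comp_assoc, hαe, fst_comp]
  have b₂ : (fst f g₂).comp f = ((snd f g₂).comp γ).comp e' := by
    rw [FrameHom.comp_assoc, hγe, fst_comp]
  -- by the Beck–Chevalley condition, both sides are compared with `w` in these two locales, where
  -- the hypothesis gives the same element up to the isomorphism between them
  refine eq_of_forall_ge_iff fun w => ?_
  rw [hβ.directImage_le_iff, hδ.directImage_le_iff, tmul_le, tmul_le,
    ← mem_copair_left (f := g₁) hα hαe b₁,
    ← mem_copair_right (f := g₂) hγ hγe b₂,
    ← tmul_le, ← tmul_le]
  have B₁ := H _ _ _ _ c₁ c₂ (A₁ c₁ c₂) (A₂ c₁ c₂)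
  have B₂ := H _ _ _ _ c₃ c₄ (A₁ c₃ c₄) (A₂ c₃ c₄)
  constructor
  · intro hw
    have d₀ : (copair (fst f g₂) ((snd f g₂).comp (fst g' h)) c₃).comp g₁ =
        ((snd f g₂).comp (snd g' h)).comp h := by
      rw [← FrameHom.comp_assoc, copair_comp_snd, c₄]
    let k : FrameHom (LocalePullback g₁ h) (LocalePullback f g₂) := copair _ _ d₀
    have hk : k (tmul (tmul x y) z) = tmul x (tmul y z) := by
      change copair _ _ d₀ _ = _
      rw [copair_tmul, copair_tmul, inf_assoc]
      change _ ⊓ (snd f g₂ (fst g' h y) ⊓ snd f g₂ (snd g' h z)) = _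
      rw [← map_inf, fst_inf_snd, fst_inf_snd]
    refine hk.symm.le.trans ((OrderHomClass.mono k hw).trans (le_of_eq ?_))
    refine (DFunLike.congr_fun (f := k.comp ((copair _ _ b₁).comp β)) ?_ w).trans
      ((DFunLike.congr_fun B₂ w).trans
        (DFunLike.congr_fun (copair_congr rfl ?_ (A₂ c₃ c₄) b₂) (δ w)))
    · rw [← FrameHom.comp_assoc, comp_copair]
      congr 1
      apply copair_congr
      · rw [← FrameHom.comp_assoc, copair_comp_fst]
      · exact copair_comp_snd _ _ _
    · rw [e₂]
  · intro hw
    have d₀ : ((fst g₁ h).comp (fst f g)).comp f =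
        (copair ((fst g₁ h).comp (snd f g)) (snd g₁ h) c₂).comp g₂ := by
      rw [← FrameHom.comp_assoc, copair_comp_fst, c₁]
    let k : FrameHom (LocalePullback f g₂) (LocalePullback g₁ h) := copair _ _ d₀
    have hk : k (tmul x (tmul y z)) = tmul (tmul x y) z := by
      change copair _ _ d₀ _ = _
      rw [copair_tmul, copair_tmul, ← inf_assoc]
      change fst g₁ h (fst f g x) ⊓ fst g₁ h (snd f g y) ⊓ _ = _
      rw [← map_inf, fst_inf_snd, fst_inf_snd]
    refine hk.symm.le.trans ((OrderHomClass.mono k hw).trans (le_of_eq ?_))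
    refine (DFunLike.congr_fun (f := k.comp ((copair _ _ b₂).comp δ)) ?_ w).trans
      ((DFunLike.congr_fun B₁.symm w).trans
        (DFunLike.congr_fun (copair_congr ?_ rfl (A₁ c₁ c₂) b₁) (β w)))
    · rw [← FrameHom.comp_assoc, comp_copair]
      congr 1
      apply copair_congr
      · exact copair_comp_fst _ _ _
      · rw [← FrameHom.comp_assoc, copair_comp_snd]
    · rw [e₁]

end LocalePullback

/-! ### Groupoids and their actions on generalized points -/

namespace LocalicGroupoid

variable {G₀ G₁ : Type u} [Order.Frame G₀] [Order.Frame G₁] (G : LocalicGroupoid G₀ G₁)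

/-- The action of a groupoid on its locale of arrows by left multiplication, with anchor map `d`. -/
def selfAction : GLocale G G₁ where
  p := G.d
  act := G.m
  act_p := G.m_d
  act_assoc := G.mul_assoc
  unit_act := G.unit_mul

variable {G} {Z Z' : Type u} [Order.Frame Z] [Order.Frame Z']

theorem pmul_congr {g g' h h' : FrameHom G₁ Z} (hg : g = g') (hh : h = h')
    (c : g.comp G.r = h.comp G.d) (c' : g'.comp G.r = h'.comp G.d) :
    G.pmul g h c = G.pmul g' h' c' := by
  subst hg hh
  rfl

theorem comp_pmul (k : FrameHom Z Z') {g h : FrameHom G₁ Z} (c : g.comp G.r = h.comp G.d) :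
    k.comp (G.pmul g h c) = G.pmul (k.comp g) (k.comp h) (comp_compatible k c) := by
  rw [LocalicGroupoidData.pmul, ← FrameHom.comp_assoc, comp_copair]
  rfl

theorem inv_pmul (g : FrameHom G₁ Z) (c : (g.comp G.i).comp G.r = g.comp G.d) :
    G.pmul (g.comp G.i) g c = (g.comp G.r).comp G.u := by
  rw [FrameHom.comp_assoc, ← G.inv_mul, comp_pmul]
  rfl

theorem pmul_inv (g : FrameHom G₁ Z) (c : g.comp G.r = (g.comp G.i).comp G.d) :
    G.pmul g (g.comp G.i) c = (g.comp G.d).comp G.u := by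
  rw [FrameHom.comp_assoc, ← G.mul_inv, comp_pmul]
  rfl

theorem pmul_unit (g : FrameHom G₁ Z) (c : g.comp G.r = ((g.comp G.r).comp G.u).comp G.d) :
    G.pmul g ((g.comp G.r).comp G.u) c = g := by
  have h := comp_pmul (G := G) g (g := FrameHom.id G₁) (h := G.r.comp G.u)
    (by rw [FrameHom.comp_assoc, G.u_d, FrameHom.comp_id, FrameHom.id_comp])
  rw [G.mul_unit] at h
  exact h.symm

theorem inv_d (g : FrameHom G₁ Z) : (g.comp G.i).comp G.d = g.comp G.r := by
  rw [FrameHom.comp_assoc, G.i_d]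

theorem inv_r (g : FrameHom G₁ Z) : (g.comp G.i).comp G.r = g.comp G.d := by
  rw [FrameHom.comp_assoc, G.i_r]

/-- Inversion is an involution: `(g⁻¹)⁻¹ = (g⁻¹)⁻¹ (g⁻¹ g) = ((g⁻¹)⁻¹ g⁻¹) g = g`. -/
theorem i_comp_i : G.i.comp G.i = FrameHom.id G₁ := by
  have c₁ := inv_r (G := G) G.i
  have c₂ : G.i.comp G.r = (FrameHom.id G₁).comp G.d := by rw [G.i_r, FrameHom.id_comp]
  have h := G.mul_assoc G₁ (G.i.comp G.i) G.i (FrameHom.id G₁) c₁ c₂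
  have h₁ : G.pmul (G.pmul (G.i.comp G.i) G.i c₁) (FrameHom.id G₁)
      ((LocalicGroupoidData.pmul_r c₁).trans c₂) = FrameHom.id G₁ := by
    refine (pmul_congr ?_ rfl _ ?_).trans G.unit_mul
    · rw [inv_pmul, G.i_r]
    · rw [FrameHom.comp_assoc, G.u_r, FrameHom.comp_id, FrameHom.id_comp]
  have hr : (G.i.comp G.i).comp G.r = G.r := by rw [FrameHom.comp_assoc, G.i_r, G.i_d]
  rw [h₁] at h
  refine (h.trans ((pmul_congr rfl ?_ _ ?_).trans (pmul_unit (G := G) _ ?_))).symm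
  · rw [hr]
    exact G.inv_mul
  · rw [hr, FrameHom.comp_assoc, G.u_d, FrameHom.comp_id]
  · rw [hr, FrameHom.comp_assoc, G.u_d, FrameHom.comp_id]

variable (G) in
theorem isOpenLocaleMap_i : IsOpenLocaleMap G.i := isOpenLocaleMap_of_inverse i_comp_i i_comp_i

theorem IsOpen.isOpenLocaleMap_r (hG : G.IsOpen) : IsOpenLocaleMap G.r := by
  rw [← G.i_d]
  exact (isOpenLocaleMap_i G).comp hG

theorem IsOpen.qsupp_qstar (hG : G.IsOpen) (q : G₁) :
    G.qsupp (G.qstar q) = directImage G.r q := by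
  rw [qsupp, qstar, ← (isOpenLocaleMap_i G).directImage_comp hG, G.i_d]

end LocalicGroupoid

namespace GLocale

open LocalicGroupoid

variable {G₀ G₁ : Type u} [Order.Frame G₀] [Order.Frame G₁] {G : LocalicGroupoid G₀ G₁}
  {X : Type u} [Order.Frame X] (S : GLocale G X) {Z Z' : Type u} [Order.Frame Z] [Order.Frame Z']

theorem pact_congr {g g' : FrameHom G₁ Z} {x x' : FrameHom X Z} (hg : g = g') (hx : x = x')
    (c : g.comp G.r = x.comp S.p) (c' : g'.comp G.r = x'.comp S.p) :
    S.pact g x c = S.pact g' x' c' := by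
  subst hg hx
  rfl

theorem comp_pact (k : FrameHom Z Z') {g : FrameHom G₁ Z} {x : FrameHom X Z}
    (c : g.comp G.r = x.comp S.p) :
    k.comp (S.pact g x c) = S.pact (k.comp g) (k.comp x) (comp_compatible k c) := by
  rw [GLocaleData.pact, ← FrameHom.comp_assoc, comp_copair]
  rfl

theorem pact_fst_snd : S.pact (fst G.r S.p) (snd G.r S.p) fst_comp = S.act := by
  rw [GLocaleData.pact, copair_fst_snd, FrameHom.id_comp]

theorem unit_pact {e : FrameHom G₁ Z} {x : FrameHom X Z} (he : e = (x.comp S.p).comp G.u)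
    (c : e.comp G.r = x.comp S.p) : S.pact e x c = x := by
  have h := S.comp_pact x (g := S.p.comp G.u) (x := FrameHom.id X)
    (by rw [FrameHom.comp_assoc, G.u_r, FrameHom.comp_id, FrameHom.id_comp])
  rw [S.unit_act] at h
  subst he
  exact h.symm

/-- `g⁻¹ (g x) = x`. -/
theorem inv_pact_pact {g : FrameHom G₁ Z} {x : FrameHom X Z} (c : g.comp G.r = x.comp S.p)
    (c' : (g.comp G.i).comp G.r = (S.pact g x c).comp S.p) :
    S.pact (g.comp G.i) (S.pact g x c) c' = x := by
  refine (S.act_assoc Z (g.comp G.i) g x (inv_r g) c).symm.trans (S.unit_pact ?_ _)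
  rw [inv_pmul, c]

/-- `g (g⁻¹ x) = x`. -/
theorem pact_inv_pact {g : FrameHom G₁ Z} {x : FrameHom X Z}
    (c : (g.comp G.i).comp G.r = x.comp S.p)
    (c' : g.comp G.r = (S.pact (g.comp G.i) x c).comp S.p) :
    S.pact g (S.pact (g.comp G.i) x c) c' = x := by
  refine (S.act_assoc Z g (g.comp G.i) x (inv_d g).symm c).symm.trans (S.unit_pact ?_ _)
  rw [pmul_inv, ← c, inv_r]

/-- The action of an open groupoid is open: it is the isomorphism `(g, x) ↦ (g, g x)` followed by
the second projection of the pullback of `d` and the anchor map. -/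
theorem isOpenLocaleMap_act (hG : G.IsOpen) : IsOpenLocaleMap S.act := by
  have c₁ : (fst G.r S.p).comp G.d = S.act.comp S.p := S.act_p.symm
  have c₂ : ((fst G.d S.p).comp G.i).comp G.r = (snd G.d S.p).comp S.p := by
    rw [inv_r, fst_comp]
  have c₃ : (fst G.d S.p).comp G.r = (S.pact _ _ c₂).comp S.p := by
    rw [GLocaleData.pact_p, inv_d]
  let σ : FrameHom (LocalePullback G.d S.p) (LocalePullback G.r S.p) := copair _ _ c₁
  let τ : FrameHom (LocalePullback G.r S.p) (LocalePullback G.d S.p) := copair _ _ c₃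
  have σfst : σ.comp (fst G.d S.p) = fst G.r S.p := copair_comp_fst _ _ _
  have σsnd : σ.comp (snd G.d S.p) = S.act := copair_comp_snd _ _ _
  have τfst : τ.comp (fst G.r S.p) = fst G.d S.p := copair_comp_fst _ _ _
  have τsnd : τ.comp (snd G.r S.p) = S.pact _ _ c₂ := copair_comp_snd _ _ _
  have hστ : σ.comp τ = FrameHom.id _ := by
    apply hom_ext
    · rw [FrameHom.comp_assoc, τfst, σfst, FrameHom.id_comp]
    · rw [FrameHom.comp_assoc, τsnd, FrameHom.id_comp, comp_pact]
      refine (S.pact_congr (g' := (fst G.r S.p).comp G.i)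
        (x' := S.pact (fst G.r S.p) (snd G.r S.p) fst_comp) ?_ ?_ _ ?_).trans
          (S.inv_pact_pact _ ?_)
      · rw [← FrameHom.comp_assoc, σfst]
      · rw [σsnd, pact_fst_snd]
      all_goals rw [pact_fst_snd, inv_r, c₁]
  have hτσ : τ.comp σ = FrameHom.id _ := by
    apply hom_ext
    · rw [FrameHom.comp_assoc, σfst, τfst, FrameHom.id_comp]
    · rw [FrameHom.comp_assoc, σsnd, FrameHom.id_comp, ← pact_fst_snd, comp_pact]
      exact (S.pact_congr τfst τsnd _ c₃).trans (S.pact_inv_pact c₂ c₃)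
  rw [← σsnd]
  exact (isOpenLocaleMap_of_inverse hστ hτσ).comp (isOpenLocaleMap_snd hG)

end GLocale

namespace LocalicGroupoid

open SupTensor

variable {G₀ G₁ : Type u} [Order.Frame G₀] [Order.Frame G₁] {G : LocalicGroupoid G₀ G₁}

theorem IsOpen.isOpenLocaleMap_m (hG : G.IsOpen) : IsOpenLocaleMap G.m :=
  G.selfAction.isOpenLocaleMap_act hG

theorem IsOpen.qmul_le_iff (hG : G.IsOpen) {q q' c : G₁} :
    G.qmul q q' ≤ c ↔ (q, q') ∈ G.m c := by
  rw [qmul, hG.isOpenLocaleMap_m.directImage_le_iff, tmul_le]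

/-- The identity `d(g h) = d(g)` on elements. -/
theorem IsOpen.qsupp_qmul (hG : G.IsOpen) (q q' : G₁) :
    G.qsupp (G.qmul q q') = G.qsupp (q ⊓ G.r (G.qsupp q')) := by
  refine eq_of_forall_ge_iff fun a => ?_
  rw [qsupp, hG.directImage_le_iff, hG.qmul_le_iff, qsupp, hG.directImage_le_iff]
  change (q, q') ∈ (G.m.comp G.d) a ↔ _
  rw [G.m_d]
  exact mem_fst hG

end LocalicGroupoid

/-! ### The division map of a principal bundle -/

namespace FullyOpenPrincipalBundle

open LocalicGroupoid SupTensor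

variable {G₀ G₁ : Type u} [Order.Frame G₀] [Order.Frame G₁] {G : LocalicGroupoid G₀ G₁}
  {M X : Type u} [Order.Frame M] [Order.Frame X] (B : FullyOpenPrincipalBundle G M X)
  {Z : Type u} [Order.Frame Z]

/-- The pairing map `⟨act, π₂⟩ : G₁ ×_{G₀} X → X ×_M X`. -/
def pairing : FrameHom (LocalePullback B.π B.π) (LocalePullback G.r B.p) :=
  copair B.act (snd G.r B.p) B.act_π

theorem pairing_comp_fst : B.pairing.comp (fst B.π B.π) = B.act := copair_comp_fst _ _ _

theorem pairing_comp_snd : B.pairing.comp (snd B.π B.π) = snd G.r B.p := copair_comp_snd _ _ _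

/-- The inverse of the pairing map. -/
noncomputable def pairingInv : FrameHom (LocalePullback G.r B.p) (LocalePullback B.π B.π) :=
  FrameHom.inverse _ B.pairing_bijective

theorem pairingInv_comp_pairing : B.pairingInv.comp B.pairing = FrameHom.id _ :=
  FrameHom.inverse_comp _ B.pairing_bijective

theorem pairing_comp_pairingInv : B.pairing.comp B.pairingInv = FrameHom.id _ :=
  FrameHom.comp_inverse _ B.pairing_bijective

theorem pairingInv_comp_fst : B.pairingInv.comp (fst G.r B.p) = B.θ := rfl

theorem pairingInv_comp_snd : B.pairingInv.comp (snd G.r B.p) = snd B.π B.π := by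
  rw [← pairing_comp_snd, ← FrameHom.comp_assoc, pairingInv_comp_pairing, FrameHom.id_comp]

theorem pairingInv_comp_act : B.pairingInv.comp B.act = fst B.π B.π := by
  rw [← pairing_comp_fst, ← FrameHom.comp_assoc, pairingInv_comp_pairing, FrameHom.id_comp]

theorem pairing_comp_θ : B.pairing.comp B.θ = fst G.r B.p := by
  rw [← pairingInv_comp_fst, ← FrameHom.comp_assoc, pairing_comp_pairingInv, FrameHom.id_comp]

theorem θ_comp_r : B.θ.comp G.r = (snd B.π B.π).comp B.p := by
  rw [← pairingInv_comp_fst, FrameHom.comp_assoc, fst_comp, ← FrameHom.comp_assoc,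
    pairingInv_comp_snd]

theorem isOpenLocaleMap_θ : IsOpenLocaleMap B.θ :=
  (isOpenLocaleMap_of_inverse B.pairingInv_comp_pairing B.pairing_comp_pairingInv).comp
    (isOpenLocaleMap_fst B.p_isOpen)

/-- The generalized point `θ(x, y)` for generalized points `x, y : Z → X` over the same point
of `M`. -/
noncomputable def pdiv (x y : FrameHom X Z) (h : x.comp B.π = y.comp B.π) : FrameHom G₁ Z :=
  (copair x y h).comp B.θ

theorem pdiv_r {x y : FrameHom X Z} (h : x.comp B.π = y.comp B.π) :
    (B.pdiv x y h).comp G.r = y.comp B.p := by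
  rw [pdiv, FrameHom.comp_assoc, θ_comp_r, ← FrameHom.comp_assoc, copair_comp_snd]

/-- `θ(x, y) y = x`. -/
theorem pact_pdiv {x y : FrameHom X Z} (h : x.comp B.π = y.comp B.π) :
    B.pact (B.pdiv x y h) y (B.pdiv_r h) = x := by
  have h₁ : B.pact B.θ (snd B.π B.π) B.θ_comp_r = fst B.π B.π := by
    rw [← pairingInv_comp_act, ← B.pact_fst_snd, B.comp_pact]
    exact B.pact_congr rfl B.pairingInv_comp_snd.symm _ _
  have h₂ := B.comp_pact (copair x y h) B.θ_comp_r
  rw [h₁, copair_comp_fst] at h₂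
  exact (B.pact_congr rfl (copair_comp_snd _ _ _).symm _ _).trans h₂.symm

theorem pdiv_d {x y : FrameHom X Z} (h : x.comp B.π = y.comp B.π) :
    (B.pdiv x y h).comp G.d = x.comp B.p := by
  rw [← GLocaleData.pact_p (B.pdiv_r h), pact_pdiv]

/-- The action is free: `θ(g y, y) = g`. -/
theorem pdiv_eq {x y : FrameHom X Z} (h : x.comp B.π = y.comp B.π) {g : FrameHom G₁ Z}
    (c : g.comp G.r = y.comp B.p) (hx : B.pact g y c = x) : B.pdiv x y h = g := by
  have : copair x y h = (copair g y c).comp B.pairing := by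
    apply hom_ext
    · rw [FrameHom.comp_assoc, pairing_comp_fst, copair_comp_fst]
      exact hx.symm
    · rw [FrameHom.comp_assoc, pairing_comp_snd, copair_comp_snd, copair_comp_snd]
  rw [pdiv, this, FrameHom.comp_assoc, pairing_comp_θ, copair_comp_fst]

/-- `θ(g x, y) = g θ(x, y)`. -/
theorem pdiv_pact {g : FrameHom G₁ Z} {x y : FrameHom X Z} (c : g.comp G.r = x.comp B.p)
    (h : x.comp B.π = y.comp B.π) (h' : (B.pact g x c).comp B.π = y.comp B.π)
    (c' : g.comp G.r = (B.pdiv x y h).comp G.d) :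
    B.pdiv (B.pact g x c) y h' = G.pmul g (B.pdiv x y h) c' := by
  refine B.pdiv_eq h' ((LocalicGroupoidData.pmul_r c').trans (B.pdiv_r h)) ?_
  refine (B.act_assoc Z g (B.pdiv x y h) y c' (B.pdiv_r h)).trans ?_
  exact B.pact_congr rfl (B.pact_pdiv h) _ _

/-- `θ(y, x) = θ(x, y)⁻¹`. -/
theorem pdiv_comm {x y : FrameHom X Z} (h : x.comp B.π = y.comp B.π) :
    B.pdiv y x h.symm = (B.pdiv x y h).comp G.i := by
  have c : ((B.pdiv x y h).comp G.i).comp G.r = x.comp B.p := by rw [inv_r, pdiv_d]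
  refine B.pdiv_eq h.symm c ?_
  refine (B.pact_congr rfl (B.pact_pdiv h).symm _ ?_).trans
    (B.inv_pact_pact (B.pdiv_r h) ?_)
  all_goals rw [pact_pdiv, c]

/-- `θ(x, x)` is the unit at `p x`. -/
theorem pdiv_self (x : FrameHom X Z) : B.pdiv x x rfl = (x.comp B.p).comp G.u :=
  B.pdiv_eq rfl (by rw [FrameHom.comp_assoc, G.u_r, FrameHom.comp_id]) (B.unit_pact rfl _)

/-! ### The principal `𝒪(G)`-locale of a principal bundle -/

variable {B}

theorem opens_smul_le_iff (hG : G.IsOpen) {q : G₁} {x y : X} :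
    B.opens.smul q x ≤ y ↔ (q, x) ∈ B.act y :=
  ((B.isOpenLocaleMap_act hG).directImage_le_iff).trans tmul_le

theorem opens_inner_le_iff {x y : X} {c : G₁} :
    B.opens.inner x y ≤ c ↔ (x, y) ∈ B.θ c :=
  B.isOpenLocaleMap_θ.directImage_le_iff.trans tmul_le

/-- The identity `(g h) x = g (h x)` on elements. -/
theorem opens_mul_smul (hG : G.IsOpen) (q q' : G₁) (x : X) :
    B.opens.smul (G.qmul q q') x = B.opens.smul q (B.opens.smul q' x) := by
  refine directImage_assoc hG.isOpenLocaleMap_m (B.isOpenLocaleMap_act hG)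
    (B.isOpenLocaleMap_act hG) (B.isOpenLocaleMap_act hG) G.m_r B.act_p ?_ q q' x
  intro Z _ g h x c₁ c₂ _ _
  exact B.act_assoc Z g h x c₁ c₂

/-- The identity `θ(g x, y) = g θ(x, y)` on elements. -/
theorem opens_inner_smul (hG : G.IsOpen) (q : G₁) (x y : X) :
    B.opens.inner (B.opens.smul q x) y = G.qmul q (B.opens.inner x y) := by
  have θd : B.θ.comp G.d = (fst B.π B.π).comp B.p := by
    have := B.pdiv_d (fst_comp (f := B.π) (g := B.π))
    rwa [pdiv, copair_fst_snd, FrameHom.id_comp] at this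
  refine directImage_assoc (B.isOpenLocaleMap_act hG) B.isOpenLocaleMap_θ
    B.isOpenLocaleMap_θ hG.isOpenLocaleMap_m B.act_π θd ?_ q x y
  intro Z _ g x y c₁ c₂ c₃ c₄
  exact B.pdiv_pact c₁ c₂ c₃ c₄

/-- The identity `θ(x, y) = θ(y, x)⁻¹` on elements. -/
theorem opens_inner_star (x y : X) :
    B.opens.inner x y = G.qstar (B.opens.inner y x) := by
  have key : (swap B.π B.π).comp B.θ = B.θ.comp G.i := by
    have := B.pdiv_comm (fst_comp (f := B.π) (g := B.π))
    rwa [pdiv, pdiv, copair_fst_snd, FrameHom.id_comp] at this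
  refine eq_of_forall_ge_iff fun c => ?_
  rw [qstar, (isOpenLocaleMap_i G).directImage_le_iff, opens_inner_le_iff, opens_inner_le_iff,
    ← mem_swap]
  exact iff_of_eq (congrArg ((y, x) ∈ ·) (DFunLike.congr_fun key c))

theorem opens_isModule (hG : G.IsOpen) : B.opens.IsModule where
  smul_sSup q s := by
    change directImage B.act (tmul q (sSup s)) = _
    rw [tmul_sSup_right, (B.isOpenLocaleMap_act hG).directImage_sSup, Set.image_image]
    rfl
  sSup_smul s x := by
    change directImage B.act (tmul (sSup s) x) = _
    rw [tmul_sSup_left, (B.isOpenLocaleMap_act hG).directImage_sSup, Set.image_image]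
    rfl
  mul_smul := opens_mul_smul hG
  lact_sSup a s := by
    change B.p a ⊓ sSup s = _
    rw [inf_sSup_eq, sSup_image]
    rfl
  sSup_lact s x := by
    change B.p (sSup s) ⊓ x = _
    rw [map_sSup, sSup_inf_eq, sSup_image, iSup_image]
    rfl
  inf_lact a b x := by
    change B.p (a ⊓ b) ⊓ x = B.p a ⊓ (B.p b ⊓ x)
    rw [map_inf, inf_assoc]
  top_lact x := by
    change B.p ⊤ ⊓ x = x
    rw [map_top, top_inf_eq]
  lact_smul a q x := by
    change directImage B.act (tmul (G.d a ⊓ q) x) = B.p a ⊓ directImage B.act (tmul q x)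
    have h : B.act (B.p a) = tmul (G.d a) ⊤ := DFunLike.congr_fun B.act_p a
    rw [inf_comm (B.p a), ← (B.isOpenLocaleMap_act hG).frobenius, h, tmul_inf_tmul, inf_top_eq,
      inf_comm]
  ract_smul q a x := by
    change directImage B.act (tmul (q ⊓ G.r a) x) = directImage B.act (tmul q (B.p a ⊓ x))
    exact congrArg _ (tmul_balanced q a x)
  lact_inf a x y := (inf_assoc _ _ _).symm

theorem opens_isPreHilbert (hG : G.IsOpen) : B.opens.IsPreHilbert where
  toIsModule := opens_isModule hG
  inner_smul := opens_inner_smul hG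
  inner_lact a x := by
    change G.d a ⊓ directImage B.θ (tmul x ⊤) = directImage B.θ (tmul (B.p a ⊓ x) ⊤)
    have θd : B.θ (G.d a) = tmul (B.p a) ⊤ := by
      have := B.pdiv_d (fst_comp (f := B.π) (g := B.π))
      rw [pdiv, copair_fst_snd, FrameHom.id_comp] at this
      exact DFunLike.congr_fun this a
    rw [inf_comm, ← B.isOpenLocaleMap_θ.frobenius, θd, tmul_inf_tmul, inf_top_eq, inf_comm]
  inner_sSup s y := by
    change directImage B.θ (tmul (sSup s) y) = _
    rw [tmul_sSup_left, B.isOpenLocaleMap_θ.directImage_sSup, Set.image_image]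
    rfl
  inner_star := opens_inner_star

/-- The unit law on elements: `p (υ q) ∧ x ≤ q · x`. -/
theorem unit_inf_le_opens_smul (hG : G.IsOpen) (q : G₁) (x : X) :
    B.p (G.u q) ⊓ x ≤ B.opens.smul q x := by
  have h := le_copair (B.p.comp G.u) (FrameHom.id X)
    (by rw [FrameHom.comp_assoc, G.u_r, FrameHom.comp_id, FrameHom.id_comp])
    ((opens_smul_le_iff hG).1 (le_refl (B.opens.smul q x)))
  exact h.trans (DFunLike.congr_fun B.unit_act _).le

/-- The identity `θ(x, x) = u(p x)` on elements. -/
theorem le_anchor_unit_opens_inner (x : X) :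
    x ≤ B.p (G.u (B.opens.inner x x)) := by
  have h := DFunLike.congr_fun (B.pdiv_self (FrameHom.id X)) (B.opens.inner x x)
  refine le_trans ?_ h.le
  have h' : (x, x) ∈ B.θ (B.opens.inner x x) := opens_inner_le_iff.1 le_rfl
  exact (le_inf le_rfl le_rfl).trans (le_copair (FrameHom.id X) (FrameHom.id X) rfl h')

theorem opens_isStablySupported (hG : G.IsOpen) : B.opens.IsStablySupported where
  toIsPreHilbert := opens_isPreHilbert hG
  supp_mono := B.p_isOpen.directImage_mono
  supp_top := B.p_isOpen.directImage_top B.p_surj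
  supp_le x := by
    refine le_trans ?_ (unit_inf_le_opens_smul hG (B.opens.inner x x) ⊤)
    exact inf_le_inf_right _ (OrderHomClass.mono B.p
      (B.p_isOpen.directImage_le_iff.2 (le_anchor_unit_opens_inner x)))
  supp_lact x := inf_eq_right.2 (B.p_isOpen.gc.le_u_l x)
  supp_smul_le q x := by
    change directImage B.p (B.opens.smul q x) ≤ _
    rw [B.p_isOpen.directImage_le_iff, opens_smul_le_iff hG]
    change _ ∈ (B.act.comp B.p) (G.qsupp q)
    rw [B.act_p]
    exact lower (fst G.r B.p (G.d (G.qsupp q))) (hG.gc.le_u_l q) le_top (mem_tmul _ _)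

theorem opens_αStar (hG : G.IsOpen) (x : X) : B.opens.αStar x = B.act x := by
  refine Eq.trans ?_ (eq_sSup_tmul (B.act x)).symm
  refine congrArg sSup (Set.ext fun t => ⟨?_, ?_⟩)
  · rintro ⟨q, y, h, rfl⟩
    exact ⟨(q, y), (opens_smul_le_iff hG).1 h, rfl⟩
  · rintro ⟨w, h, rfl⟩
    exact ⟨w.1, w.2, (opens_smul_le_iff hG).2 h, rfl⟩

theorem opens_isQLocale (hG : G.IsOpen) : B.opens.IsQLocale where
  toIsStablySupported := opens_isStablySupported hG
  Q1 s := by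
    rw [opens_αStar hG, map_sSup]
    exact congrArg sSup (Set.image_congr fun x _ => (opens_αStar hG x).symm)
  Q2 x := by
    have c : (B.p.comp G.u).comp G.r = (FrameHom.id X).comp B.p := by
      rw [FrameHom.comp_assoc, G.u_r, FrameHom.comp_id, FrameHom.id_comp]
    have h : B.pact (B.p.comp G.u) (FrameHom.id X) c x = x :=
      DFunLike.congr_fun B.unit_act x
    apply le_antisymm
    · refine sSup_le ?_
      rintro _ ⟨q, y, hq, rfl⟩
      exact (unit_inf_le_opens_smul hG q y).trans hq
    · refine h.symm.le.trans (copair_le _ _ c fun q y hq => le_sSup ?_)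
      exact ⟨q, y, (opens_smul_le_iff hG).2 hq, rfl⟩

theorem opens_isPrincipal (hG : G.IsOpen) : B.opens.IsPrincipal where
  toIsQLocale := opens_isQLocale hG
  P1 := ⟨B.π_isOpen, B.π_isOpen.directImage_top B.π_surj⟩
  P2 q x := by
    refine eq_of_forall_ge_iff fun m => ?_
    rw [hG.qsupp_qstar]
    refine B.π_isOpen.directImage_le_iff.trans (Iff.trans ?_ B.π_isOpen.directImage_le_iff.symm)
    rw [opens_smul_le_iff hG]
    change _ ∈ (B.act.comp B.π) m ↔ _
    rw [B.act_π]
    exact mem_snd hG.isOpenLocaleMap_r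
  P3 := by
    refine ⟨FrameHom.orderIsoOfBijective _ B.pairing_bijective, fun x y => ?_⟩
    change copair B.act (snd G.r B.p) B.act_π (tmul x y) = _
    rw [copair_tmul, ← opens_αStar hG, PrincipalLocaleData.αStar]
    exact sSup_tmul_inf_snd (f := G.r) (g := B.p) (fun q z => B.opens.smul q z ≤ x) y

end FullyOpenPrincipalBundle

/-! ### The principal bundle of a principal `𝒪(G)`-locale -/

theorem monotone_of_map_sSup {L M : Type u} [CompleteLattice L] [CompleteLattice M] {f : L → M}
    (hf : ∀ s, f (sSup s) = sSup (f '' s)) : Monotone f := fun a b hab => by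
  have h := hf {a, b}
  rw [sSup_pair, sup_eq_right.2 hab] at h
  rw [h]
  exact le_sSup ⟨a, Or.inl rfl, rfl⟩

namespace PrincipalLocaleData

open LocalicGroupoid SupTensor

variable {G₀ G₁ : Type u} [Order.Frame G₀] [Order.Frame G₁] {G : LocalicGroupoid G₀ G₁}
  {M X : Type u} [Order.Frame M] [Order.Frame X]

theorem IsModule.smul_mono {S : PrincipalLocaleData G M X} (hS : S.IsModule) {q q' : G₁}
    {x x' : X} (hq : q ≤ q') (hx : x ≤ x') : S.smul q x ≤ S.smul q' x' :=
  (monotone_of_map_sSup (hS.smul_sSup q) hx).trans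
    (monotone_of_map_sSup (f := fun q => S.smul q x') (fun s => hS.sSup_smul s x') hq)

/-- The action of the base locale of a module is `ᵃx = p a ∧ x` for a frame homomorphism `p`,
namely `p a = ᵃ1`. -/
theorem IsModule.exists_anchor {S : PrincipalLocaleData G M X} (hS : S.IsModule) :
    ∃ p : FrameHom G₀ X, S.lact = fun a x => p a ⊓ x := by
  have h : ∀ a x, S.lact a x = S.lact a ⊤ ⊓ x := fun a x => by rw [← hS.lact_inf, top_inf_eq]
  refine ⟨⟨⟨⟨fun a => S.lact a ⊤, fun a b => ?_⟩, hS.top_lact ⊤⟩, fun s => hS.sSup_lact s ⊤⟩, ?_⟩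
  · rw [hS.inf_lact, h]
  · funext a x
    exact h a x

/-- The data of a principal `𝒪(G)`-locale in which the base locale acts through a frame
homomorphism `p`, by `ᵃx = p a ∧ x`. -/
abbrev ofAnchor (G : LocalicGroupoid G₀ G₁) (p : FrameHom G₀ X) (smul : G₁ → X → X)
    (inner : X → X → G₁) (supp : X → G₀) (proj : FrameHom M X) : PrincipalLocaleData G M X where
  lact a x := p a ⊓ x
  smul := smul
  inner := inner
  supp := supp
  proj := proj

variable {p : FrameHom G₀ X} {smul : G₁ → X → X} {inner : X → X → G₁} {supp : X → G₀}
  {proj : FrameHom M X}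

theorem top_le_smul_inner_top (hS : (ofAnchor G p smul inner supp proj).IsSupported) :
    ⊤ ≤ smul (inner ⊤ ⊤) ⊤ := by
  have h := hS.supp_le ⊤
  rw [hS.supp_top] at h
  change p ⊤ ⊓ ⊤ ≤ _ at h
  rwa [map_top, inf_top_eq] at h

theorem inner_mono_right (hS : (ofAnchor G p smul inner supp proj).IsPreHilbert) {y y' : X}
    (x : X) (hy : y ≤ y') : inner x y ≤ inner x y' := by
  have h₁ : inner x y = G.qstar (inner y x) := hS.inner_star x y
  have h₂ : inner x y' = G.qstar (inner y' x) := hS.inner_star x y'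
  rw [h₁, h₂]
  exact (isOpenLocaleMap_i G).directImage_mono
    (monotone_of_map_sSup (f := fun y => inner y x) (fun s => hS.inner_sSup s x) hy)

theorem inner_anchor_inf (hS : (ofAnchor G p smul inner supp proj).IsPreHilbert) (a : G₀)
    (x : X) : inner (p a ⊓ x) ⊤ = inner x ⊤ ⊓ G.d a :=
  (hS.inner_lact a x).symm.trans (inf_comm _ _)

theorem supp_anchor_le (hG : G.IsOpen)
    (hS : (ofAnchor G p smul inner supp proj).IsStablySupported) (a : G₀) : supp (p a) ≤ a := by
  -- `p a = ᵃ1 = ᵃ(⟨1, 1⟩ · 1) = (ᵃ⟨1, 1⟩) · 1`, because `⟨1, 1⟩ · 1 = 1`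
  have h : p a = smul (G.qlact a (inner ⊤ ⊤)) ⊤ := by
    refine Eq.trans ?_ (hS.lact_smul a (inner ⊤ ⊤) ⊤).symm
    exact (inf_eq_left.2 (le_top.trans (top_le_smul_inner_top hS.toIsSupported))).symm
  rw [h]
  exact (hS.supp_smul_le _ _).trans (hG.directImage_le_iff.2 inf_le_left)

theorem gc_supp_anchor (hG : G.IsOpen)
    (hS : (ofAnchor G p smul inner supp proj).IsStablySupported) : GaloisConnection supp p :=
  fun x _ => ⟨fun h => (inf_eq_right.1 (hS.supp_lact x)).trans (OrderHomClass.mono p h),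
    fun h => (hS.supp_mono h).trans (supp_anchor_le hG hS _)⟩

theorem qsupp_inner_le_supp (hG : G.IsOpen)
    (hS : (ofAnchor G p smul inner supp proj).IsStablySupported) (x : X) :
    G.qsupp (inner x ⊤) ≤ supp x := by
  have h := inner_anchor_inf hS.toIsPreHilbert (supp x) x
  rw [show p (supp x) ⊓ x = x from hS.supp_lact x] at h
  exact hG.directImage_le_iff.2 (h.le.trans inf_le_right)

theorem qsupp_inner_anchor_inf (hG : G.IsOpen)
    (hS : (ofAnchor G p smul inner supp proj).IsStablySupported) (a : G₀) (x : X) :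
    G.qsupp (inner (p a ⊓ x) ⊤) = G.qsupp (inner x ⊤) ⊓ a := by
  rw [inner_anchor_inf hS.toIsPreHilbert, qsupp, hG.frobenius]
  rfl

theorem le_supp_anchor (hG : G.IsOpen)
    (hS : (ofAnchor G p smul inner supp proj).IsStablySupported) (a : G₀) : a ≤ supp (p a) := by
  have h₁ : (⊤ : G₀) ≤ G.qsupp (inner ⊤ ⊤) := by
    rw [← show supp ⊤ = ⊤ from hS.supp_top]
    exact (hS.supp_mono (top_le_smul_inner_top hS.toIsSupported)).trans (hS.supp_smul_le _ _)
  have h₂ := qsupp_inner_anchor_inf hG hS a ⊤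
  rw [top_le_iff.1 h₁, top_inf_eq, inf_top_eq] at h₂
  exact h₂.symm.le.trans (qsupp_inner_le_supp hG hS _)

/-- The support of a stably supported module is determined by the inner product. -/
theorem supp_eq_qsupp_inner (hG : G.IsOpen)
    (hS : (ofAnchor G p smul inner supp proj).IsStablySupported) (x : X) :
    supp x = G.qsupp (inner x ⊤) := by
  apply le_antisymm _ (qsupp_inner_le_supp hG hS x)
  have h : p (supp x) ≤ smul (inner x x) ⊤ := by
    have := hS.supp_le x
    change p (supp x) ⊓ ⊤ ≤ _ at this
    rwa [inf_top_eq] at this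
  calc supp x ≤ supp (p (supp x)) := le_supp_anchor hG hS _
    _ ≤ supp (smul (inner x x) ⊤) := hS.supp_mono h
    _ ≤ G.qsupp (inner x x) := hS.supp_smul_le _ _
    _ ≤ G.qsupp (inner x ⊤) :=
      hG.directImage_mono (inner_mono_right hS.toIsPreHilbert x le_top)

theorem directImage_anchor (hG : G.IsOpen)
    (hS : (ofAnchor G p smul inner supp proj).IsStablySupported) : directImage p = supp :=
  directImage_eq_of_gc (gc_supp_anchor hG hS)

theorem isOpenLocaleMap_anchor (hG : G.IsOpen)
    (hS : (ofAnchor G p smul inner supp proj).IsStablySupported) : IsOpenLocaleMap p :=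
  .of_gc (gc_supp_anchor hG hS) fun x a => by
    rw [supp_eq_qsupp_inner hG hS x, supp_eq_qsupp_inner hG hS (x ⊓ p a), inf_comm x,
      qsupp_inner_anchor_inf hG hS]

theorem isLocaleSurjection_anchor (hG : G.IsOpen)
    (hS : (ofAnchor G p smul inner supp proj).IsStablySupported) : IsLocaleSurjection p :=
  (isOpenLocaleMap_anchor hG hS).isLocaleSurjection (by
    rw [directImage_anchor hG hS]
    exact hS.supp_top)

/-- The identity `p(g x) = d(g)` on elements. -/
theorem supp_smul (hG : G.IsOpen)
    (hS : (ofAnchor G p smul inner supp proj).IsStablySupported) (q : G₁) (x : X) :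
    supp (smul q x) = G.qsupp (q ⊓ G.r (supp x)) := by
  have h : inner (smul q x) ⊤ = G.qmul q (inner x ⊤) := hS.inner_smul q x ⊤
  rw [supp_eq_qsupp_inner hG hS, h, hG.qsupp_qmul, ← supp_eq_qsupp_inner hG hS]

theorem smul_le_anchor_iff (hG : G.IsOpen)
    (hS : (ofAnchor G p smul inner supp proj).IsStablySupported) {q : G₁} {x : X} {a : G₀} :
    smul q x ≤ p a ↔ (q, x) ∈ fst G.r p (G.d a) := by
  rw [← gc_supp_anchor hG hS, supp_smul hG hS, qsupp, hG.directImage_le_iff,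
    mem_fst (isOpenLocaleMap_anchor hG hS), directImage_anchor hG hS]

/-- The element `{(q, y) | q · y ≤ x}` of `Q ⊗_A X`. -/
def smulAdjoint (hS : (ofAnchor G p smul inner supp proj).IsModule) (x : X) :
    LocalePullback G.r p where
  carrier := {w | smul w.1 w.2 ≤ x}
  lower' := fun hq hy h => (hS.smul_mono hq hy).trans h
  sSup_left' := fun s y h => by
    refine (hS.sSup_smul s y).le.trans (sSup_le ?_)
    rintro _ ⟨q, hq, rfl⟩
    exact h q hq
  sSup_right' := fun q s h => by
    refine (hS.smul_sSup q s).le.trans (sSup_le ?_)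
    rintro _ ⟨y, hy, rfl⟩
    exact h y hy
  balanced' := fun q a y => iff_of_eq (congrArg (· ≤ x) (hS.ract_smul q a y))

theorem αStar_eq_smulAdjoint (hS : (ofAnchor G p smul inner supp proj).IsModule) (x : X) :
    (ofAnchor G p smul inner supp proj).αStar x = smulAdjoint hS x := by
  refine Eq.trans ?_ (eq_sSup_tmul (smulAdjoint hS x)).symm
  refine congrArg sSup (Set.ext fun t => ⟨?_, ?_⟩)
  · rintro ⟨q, y, h, rfl⟩
    exact ⟨(q, y), h, rfl⟩
  · rintro ⟨w, h, rfl⟩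
    exact ⟨w.1, w.2, h, rfl⟩

/-- The map of locales `G₁ ×_{G₀} X → X` with inverse image `α_*`. It preserves finite meets
because it is a right adjoint, and joins by Q1. -/
def IsQLocale.act (hS : (ofAnchor G p smul inner supp proj).IsQLocale) :
    FrameHom X (LocalePullback G.r p) where
  toFun := smulAdjoint hS.toIsModule
  map_inf' x y := by
    apply SupTensor.ext
    ext w
    change smul w.1 w.2 ≤ x ⊓ y ↔ w ∈ smulAdjoint hS.toIsModule x ⊓ smulAdjoint hS.toIsModule y
    rw [le_inf_iff, mem_inf]
    rfl
  map_top' := by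
    apply SupTensor.ext
    ext w
    exact ⟨fun _ => mem_top w, fun _ => le_top⟩
  map_sSup' s := by
    rw [← αStar_eq_smulAdjoint]
    exact (hS.Q1 s).trans
      (congrArg sSup (Set.image_congr fun x _ => αStar_eq_smulAdjoint hS.toIsModule x))

theorem IsQLocale.mem_act (hS : (ofAnchor G p smul inner supp proj).IsQLocale) {q : G₁}
    {x y : X} : (q, x) ∈ hS.act y ↔ smul q x ≤ y := Iff.rfl

theorem IsQLocale.directImage_act (hS : (ofAnchor G p smul inner supp proj).IsQLocale)
    (q : G₁) (x : X) : directImage hS.act (tmul q x) = smul q x :=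
  le_antisymm (sInf_le (tmul_le.2 (hS.mem_act.2 le_rfl)))
    (le_sInf fun _ h => hS.mem_act.1 (tmul_le.1 h))

/-- The `G`-locale data of a `Q`-locale. -/
def IsQLocale.toGLocaleData (hG : G.IsOpen)
    (hS : (ofAnchor G p smul inner supp proj).IsQLocale) : GLocaleData G X where
  p := p
  act := hS.act
  act_p := by
    ext a w
    exact smul_le_anchor_iff hG hS.toIsStablySupported

/-- The `G`-locale of a `Q`-locale. The two sides of the associativity law for `g`, `h` and `x` at
`w` are the joins of `g q ∧ h q' ∧ x y` over `(q q') · y ≤ w` and over `q · (q' · y) ≤ w`; the unit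
law is Q2. -/
def IsQLocale.toGLocale (hG : G.IsOpen)
    (hS : (ofAnchor G p smul inner supp proj).IsQLocale) : GLocale G X where
  toGLocaleData := hS.toGLocaleData hG
  act_assoc Z _ g h x hgh hhx := by
    replace hhx : h.comp G.r = x.comp p := hhx
    have c₁ : (G.pmul g h hgh).comp G.r = x.comp p :=
      (LocalicGroupoidData.pmul_r hgh).trans hhx
    have c₂ : g.comp G.r = ((hS.toGLocaleData hG).pact h x hhx).comp p :=
      hgh.trans (GLocaleData.pact_p (S := hS.toGLocaleData hG) hhx).symm
    ext w
    have hms : ∀ q q' y, smul (G.qmul q q') y = smul q (smul q' y) := hS.mul_smul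
    apply le_antisymm
    · refine copair_le _ _ c₁ fun q y hq => ?_
      change copair g h hgh (G.m q) ⊓ x y ≤ _
      rw [copair_apply, iSup₂_inf_eq]
      refine iSup₂_le fun v hv => ?_
      have h₁ : (v.2, y) ∈ hS.act (smul v.2 y) := le_rfl
      have h₂ : (v.1, smul v.2 y) ∈ hS.act w := by
        rw [hS.mem_act, ← hms]
        exact (hS.smul_mono (hG.qmul_le_iff.2 hv) le_rfl).trans hq
      rw [inf_assoc]
      exact (inf_le_inf_left _ (le_copair h x hhx h₁)).trans (le_copair g _ c₂ h₂)
    · refine copair_le _ _ c₂ fun q y' hq => ?_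
      change g q ⊓ copair h x hhx (hS.act y') ≤ _
      rw [copair_apply, inf_iSup₂_eq]
      refine iSup₂_le fun v hv => ?_
      have h₁ : (q, v.1) ∈ G.m (G.qmul q v.1) := hG.qmul_le_iff.1 le_rfl
      have h₂ : (G.qmul q v.1, v.2) ∈ hS.act w := by
        rw [hS.mem_act, hms]
        exact (hS.smul_mono le_rfl hv).trans hq
      rw [← inf_assoc]
      exact (inf_le_inf_right _ (le_copair g h hgh h₁)).trans (le_copair _ x c₁ h₂)
  unit_act := by
    have c : (p.comp G.u).comp G.r = (FrameHom.id X).comp p := by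
      rw [FrameHom.comp_assoc, G.u_r, FrameHom.comp_id, FrameHom.id_comp]
    ext w
    refine Eq.trans ?_ (hS.Q2 w)
    apply le_antisymm
    · exact copair_le _ _ c fun q y hq => le_sSup ⟨q, y, hq, rfl⟩
    · refine sSup_le ?_
      rintro _ ⟨q, y, hq, rfl⟩
      exact le_copair (p.comp G.u) (FrameHom.id X) c (D := hS.act w) hq

theorem IsPrincipal.smul_le_proj_iff (hG : G.IsOpen)
    (hS : (ofAnchor G p smul inner supp proj).IsPrincipal) {q : G₁} {x : X} {m : M} :
    smul q x ≤ proj m ↔ (q, x) ∈ snd G.r p (proj m) := by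
  have h : directImage proj (smul q x) = directImage proj (p (directImage G.r q) ⊓ x) := by
    rw [← hG.qsupp_qstar]
    exact hS.P2 q x
  have hπ : IsOpenLocaleMap proj := hS.P1.1
  rw [mem_snd hG.isOpenLocaleMap_r, ← hπ.directImage_le_iff, h, hπ.directImage_le_iff]

theorem IsPrincipal.act_proj (hG : G.IsOpen)
    (hS : (ofAnchor G p smul inner supp proj).IsPrincipal) :
    hS.act.comp proj = (snd G.r p).comp proj := by
  ext m w
  exact hS.smul_le_proj_iff hG

/-- The isomorphism of P3 is the pairing map. -/
theorem IsPrincipal.pairing_bijective (hG : G.IsOpen)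
    (hS : (ofAnchor G p smul inner supp proj).IsPrincipal) :
    Function.Bijective (copair hS.act (snd G.r p) (hS.act_proj hG)) := by
  obtain ⟨φ, hφ⟩ := hS.P3
  change LocalePullback proj proj ≃o LocalePullback G.r p at φ
  have h : ∀ x y, φ (tmul x y) = hS.act x ⊓ snd G.r p y := fun x y => by
    refine (hφ x y).trans ((sSup_tmul_inf_snd (f := G.r) (g := p)
      (fun q z => smul q z ≤ x) y).symm.trans ?_)
    exact congrArg (· ⊓ snd G.r p y) (αStar_eq_smulAdjoint hS.toIsModule x)
  have key : copair hS.act (snd G.r p) (hS.act_proj hG) =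
      (φ : FrameHom (LocalePullback proj proj) (LocalePullback G.r p)) := by
    apply hom_ext
    · rw [copair_comp_fst]
      ext1 x
      refine Eq.trans ?_ (h x ⊤).symm
      rw [map_top, inf_top_eq]
    · rw [copair_comp_snd]
      ext1 y
      refine Eq.trans ?_ (h ⊤ y).symm
      rw [map_top, top_inf_eq]
  rw [key]
  exact φ.bijective

/-- The fully open principal `G`-bundle of a principal `𝒪(G)`-locale. -/
def IsPrincipal.toBundle (hG : G.IsOpen)
    (hS : (ofAnchor G p smul inner supp proj).IsPrincipal) : FullyOpenPrincipalBundle G M X where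
  toGLocale := hS.toGLocale hG
  π := proj
  act_π := hS.act_proj hG
  π_isOpen := hS.P1.1
  π_surj := hS.P1.1.isLocaleSurjection hS.P1.2
  pairing_bijective := hS.pairing_bijective hG
  p_isOpen := isOpenLocaleMap_anchor hG hS.toIsStablySupported
  p_surj := isLocaleSurjection_anchor hG hS.toIsStablySupported

end PrincipalLocaleData

/-! ### The bijection -/

namespace FullyOpenPrincipalBundle

variable {G₀ G₁ : Type u} [Order.Frame G₀] [Order.Frame G₁] {G : LocalicGroupoid G₀ G₁}
  {M X : Type u} [Order.Frame M] [Order.Frame X]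

/-- A bundle is determined by the two actions on its frame and by its projection. -/
theorem eq_of_opens (hG : G.IsOpen) {B B' : FullyOpenPrincipalBundle G M X}
    (hl : B.opens.lact = B'.opens.lact) (hs : B.opens.smul = B'.opens.smul)
    (hπ : B.opens.proj = B'.opens.proj) : B = B' := by
  have hp : B.p = B'.p := by
    ext a
    have h : B.p a ⊓ ⊤ = B'.p a ⊓ ⊤ := congrFun (congrFun hl a) ⊤
    rwa [inf_top_eq, inf_top_eq] at h
  have hact : ∀ w q x, (q, x) ∈ B.act w ↔ (q, x) ∈ B'.act w := fun w q x => by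
    rw [← opens_smul_le_iff hG, ← opens_smul_le_iff hG, hs]
  obtain ⟨⟨⟨p, act, _⟩, _, _⟩, π, _, _, _, _, _, _⟩ := B
  obtain ⟨⟨⟨p', act', _⟩, _, _⟩, π', _, _, _, _, _, _⟩ := B'
  obtain rfl : p = p' := hp
  obtain rfl : π = π' := hπ
  obtain rfl : act = act' := by
    ext w z
    exact hact w z.1 z.2
  rfl

end FullyOpenPrincipalBundle

theorem mainTheorem1 {G₀ G₁ : Type u} [Order.Frame G₀] [Order.Frame G₁]
    (G : LocalicGroupoid G₀ G₁) (hG : G.IsOpen) (M : Type u) [Order.Frame M] :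
    ∃ h : ∀ (X : Frm.{u}) (B : FullyOpenPrincipalBundle G M X), B.opens.IsPrincipal,
      Function.Bijective
        (fun B : (Σ X : Frm.{u}, FullyOpenPrincipalBundle G M X) =>
          (⟨B.1, Quotient.mk (PrincipalLocale.setoid G M B.1) ⟨B.2.opens, h B.1 B.2⟩⟩ :
            Σ X : Frm.{u}, Quotient (PrincipalLocale.setoid G M X))) := by
  refine ⟨fun X B => FullyOpenPrincipalBundle.opens_isPrincipal hG, ?_, ?_⟩
  · rintro ⟨X, B⟩ ⟨X', B'⟩ h
    obtain ⟨hX, hB⟩ := Sigma.mk.inj h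
    obtain rfl : X = X' := hX
    obtain ⟨hl, hs, -, hπ⟩ := Quotient.exact (eq_of_heq hB)
    exact congrArg _ (FullyOpenPrincipalBundle.eq_of_opens hG hl hs hπ)
  · rintro ⟨X, S⟩
    induction S using Quotient.inductionOn with
    | _ S =>
      obtain ⟨⟨lact, smul, inner, supp, proj⟩, hS⟩ := S
      obtain ⟨p, hp⟩ := hS.toIsModule.exists_anchor
      obtain rfl : lact = fun a x => p a ⊓ x := hp
      refine ⟨⟨X, PrincipalLocaleData.IsPrincipal.toBundle hG hS⟩,
        congrArg (Sigma.mk X) (Quotient.sound ⟨rfl, ?_, ?_, rfl⟩)⟩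
      · funext q x
        exact hS.directImage_act q x
      · exact PrincipalLocaleData.directImage_anchor hG hS.toIsStablySupported
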